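/- **Conventions.** In forcing notions stronger conditions are larger. $\mathbf H$ is a function on $\omega$ with each $\mathbf H(n)$ a countable set with at least two elements; $\nu\trianglelefteq\eta$ ($\nu\vartriangleleft\eta$) means that $\nu$ is a (proper) initial segment of $\eta$. $\forall^\infty n$ means "for all but finitely many $n$". **Creating pairs.** A creature for $\mathbf H$ is a triple $t=(\mathrm{nor}[t],\mathrm{val}[t],\mathrm{dis}[t])$ with $\mathrm{nor}[t]\in\mathbb R^{\ge0}$ and, for some $m^t_{dn}<m^t_{up}<\omega$, $\emptyset\ne\mathrm{val}[t]\subseteq\{\langle u,v\rangle\in\prod_{i<m^t_{dn}}\mathbf H(i)\times\prod_{i<m^t_{up}}\mathbf H(i):u\vartriangleleft v\}$ ($\mathrm{dis}[t]$ is an arbitrary label). A creating pair $(K,\Sigma)$ is a set $K$ of creatures with $\Sigma:[K]^{<\omega}\to\mathcal P(K)$ such that: if $\Sigma(\mathcal S)\ne\emptyset$, then $\mathcal S$ has an enumeration $t_0,\dots,t_k$ with $m^{t_i}_{up}=m^{t_{i+1}}_{dn}$ (only such enumerations are used in writing $\Sigma(t_0,\dots,t_k)$); $s\in\Sigma(t_0,\dots,t_k)$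 implies $m^s_{dn}=m^{t_0}_{dn}$, $m^s_{up}=m^{t_k}_{up}$, $\mathrm{dom}(\mathrm{val}[s])=\mathrm{dom}(\mathrm{val}[t_0])$ and $\langle v\restriction m^{t_i}_{dn},v\restriction m^{t_i}_{up}\rangle\in\mathrm{val}[t_i]$ for all $\langle u,v\rangle\in\mathrm{val}[s]$, $i\le k$; $t\in\Sigma(t)$, $\Sigma(\emptyset)=\emptyset$; and if $s_i\in\Sigma(\mathcal S_i)$ for $i\le n$, then $\Sigma(s_0,\dots,s_n)\subseteq\Sigma(\bigcup_{i\le n}\mathcal S_i)$. The pair is *local* if $m^t_{up}=m^t_{dn}+1$ for all $t\in K$, and *forgetful* if $\langle u,v\rangle\in\mathrm{val}[t]$ and $w\in\prod_{i<m^t_{dn}}\mathbf H(i)$ imply $\langle w,w^\frown v\restriction[m^t_{dn},m^t_{up})\rangle\in\mathrm{val}[t]$; then $\mathrm{pos}(t)\subseteq\mathbf H(m^t_{dn})$ denotes the set of the values $v(m^t_{dn})$ for $\langle u,v\rangle\in\mathrm{val}[t]$. A local forgetful pair is *complete* if for all $i$ and nonempty $A\subseteq\mathbf H(i)$ there is a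 unique $t^i_A\in K$ with $m_{dn}=i$ and $\mathrm{pos}=A$, and $\emptyset\neq A\subseteq B$ implies $t^i_A\in\Sigma(t^i_B)$ and $\mathrm{nor}[t^i_A]\le\mathrm{nor}[t^i_B]$. It is *linked* if whenever $t_0,t_1\in K$, $\mathrm{nor}[t_0],\mathrm{nor}[t_1]>1$ and $m^{t_0}_{dn}=m^{t_1}_{dn}$, $m^{t_0}_{up}=m^{t_1}_{up}$, there is $s\in\Sigma(t_0)\cap\Sigma(t_1)$ with $\mathrm{nor}[s]\ge\min\{\mathrm{nor}[t_0],\mathrm{nor}[t_1]\}-1$; it is *$h$-linked* (for $h:\omega\times\omega\to\omega$) if for all $k>1$ and such $t_0,t_1$ with norms $\ge k$ there is $s\in\Sigma(t_0)\cap\Sigma(t_1)$ with $\mathrm{nor}[s]\ge h(m^{t_0}_{dn},k)$. **Forcing notions.** For a set $\mathcal C$ of sequences of creatures (a norm condition), conditions are $p=(w^p,t^p_0,t^p_1,\dots)$ with $t^p_i\in K$, $m^{t^p_i}_{up}=m^{t^p_{i+1}}_{dn}$, $w^p\in\mathrm{dom}(\mathrm{val}[t^p_0])$, $\mathrm{pos}(w^p,t^p_0,\dots,t^p_i)\subseteq\mathrm{dom}(\mathrm{val}[t^p_{i+1}])$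 and $\langle t^p_i:i<\omega\rangle\in\mathcal C$, where $\mathrm{pos}(w,t_0,\dots,t_i)=\{v\in\prod_{j<m^{t_i}_{up}}\mathbf H(j):w\vartriangleleft v\ \&\ (\forall j\le i)\langle v\restriction m^{t_j}_{dn},v\restriction m^{t_j}_{up}\rangle\in\mathrm{val}[t_j]\}$; $p\le q$ if $q$ is obtained from $p$ by finitely many operations of the form: replace $(w,t_0,t_1,\dots)$ by $(w^*,t_n,t_{n+1},\dots)$ with $w^*\in\mathrm{pos}(w,t_0,\dots,t_{n-1})$, or by $(w,t^*_0,t^*_1,\dots)$ with $t^*_i\in\Sigma(t_{n_i},\dots,t_{n_{i+1}-1})$, $0=n_0<n_1<\cdots$ (the intermediate results need not be in $\mathcal C$). The basic norm conditions are $\mathcal C^\infty$: $\lim_i\mathrm{nor}[t_i]=\infty$; $\mathcal C^f$ (for $f:\omega\times\omega\to\omega$): $(\forall n)(\forall^\infty i)\,\mathrm{nor}[t_i]\ge f(n,m^{t_i}_{dn})$; $\mathcal C^{\mathcal F}$ (for $\mathcal F\subseteq\omega^\omega$): $(\exists f\in\mathcal F)(\forall^\infty i)\,\mathrm{nor}[t_i]\ge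 f(m^{t_i}_{dn})$. A *1-norming system* is $(\bar K,\bar g)$, $\bar K=\langle K_\ell:\ell<\omega\rangle$, $\bar g=\langle g_\rho:\rho\in2^{<\omega}\rangle$, where the $K_\ell\subseteq\omega$ are infinite and pairwise disjoint, $\min K_\ell\ge\ell$, $g_\rho\in\prod_{m\in K_\ell}\mathbf H(m)$ for $\rho\in2^\ell$, and $g_\rho(m)$ ($\rho\in2^\ell$) are distinct for each $m\in K_\ell$. Then $\mathcal C^{\bar K,\bar g}$ consists of the sequences in $\mathcal C$ such that for some finite $R\subseteq2^\omega$, for all $i,\ell$ and $\rho\in2^\ell$: if $m^{t_i}_{dn}\in K_\ell$ and $g_\rho(m^{t_i}_{dn})\notin\mathrm{pos}(t_i)$, then $\rho\vartriangleleft x$ for some $x\in R$. A *2-norming system* is a family $\bar U=\langle U_{\rho,k}:\rho\in2^{<\omega},k<\omega\rangle$ of pairwise disjoint infinite subsets of $\omega$ with $\mathrm{lh}(\rho)\le\min U_{\rho,k}$; $\mathcal C^{\bar U}$ consists of the sequences in $\mathcal C$ such that for some finite $R\subseteq2^\omega$, $S\subseteq\omega$, for all $i,k,\rho$: if $m^{t_i}_{dn}\in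 U_{\rho,k}$ and $\mathrm{pos}(t_i)\ne\mathbf H(m^{t_i}_{dn})$, then $\rho\vartriangleleft x$ for some $x\in R$, and $k\in S$. The forcing notions for $\mathcal C^\infty,\mathcal C^f,\mathcal C^{\mathcal F}$ modified in these ways are denoted $\mathbb Q^{\bar K,\bar g}_\infty,\mathbb Q^{\bar K,\bar g}_f,\mathbb Q^{\bar K,\bar g}_{\mathcal F}$ and $\mathbb Q^{\bar U}_\infty,\mathbb Q^{\bar U}_f,\mathbb Q^{\bar U}_{\mathcal F}$. When $(K,\Sigma)$ is local, forgetful and complete, a condition is coded by $w^p$ and the sets $\mathrm{pos}(t^p_i)$, i.e. by a point of the Polish space $\big(\bigcup_n\prod_{i<n}\mathbf H(i)\big)\times\prod_n2^{\mathbf H(n)}$ (all $\mathbf H(i)$ discrete); "Borel function into $\mathbb Q$" and "$\mathbb Q$ is Souslin" (the set of conditions, the order and the incompatibility relation are $\Sigma^1_1$) refer to this coding. **Sourness.** A standard $\mathbb Q$-name $\dot\tau$ for an element of $2^\omega$ is a system $\langle q_{\eta,k}:\eta\in2^{<\omega},k<N_\eta\rangle\subseteq\mathbb Q$, $N_\eta\le\omega$,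 such that for each $n$ the family $\langle q_{\eta,k}:\eta\in2^n,k<N_\eta\rangle$ is a maximal antichain, and for $\nu\vartriangleleft\eta$, $k<N_\eta$ there is $m<N_\nu$ with $q_{\nu,m}\le q_{\eta,k}$ ($q_{\eta,k}$ forces $\eta\vartriangleleft\dot\tau$). The forcing notion $\mathbb Q$ is *very explicitly sour over Cohen* if it is ccc and there are standard $\mathbb Q$-names $\dot\tau_0,\dot\tau_1$ for elements of $2^\omega$ such that * for $\ell<2$ there is an isomorphism from $\mathrm{RO}(\mathbb C)$, $\mathbb C=2^{<\omega}$ the Cohen forcing with its generic real $\dot W$, onto the complete subalgebra of $\mathrm{RO}(\mathbb Q)$ generated by the Boolean values $[\![\eta\vartriangleleft\dot\tau_\ell]\!]$, mapping $[\![\eta\vartriangleleft\dot W]\!]$ to $[\![\eta\vartriangleleft\dot\tau_\ell]\!]$ for each $\eta\in 2^{<\omega}$; * there are Borel functions $g_0,g_1:2^\omega\times\omega\to\mathbb Q$ such that (i) $\{g_\ell(x,n):n<\omega\}$ is predense in $\mathbb Q$ for all $x$, $\ell$; (ii) if $x_0\ne x_1$, $x_0\restriction m=x_1\restriction m$ and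 $k_0,k_1<m$, then there are $n$ and disjoint $A_0,A_1\subseteq2^n$ such that for $\ell<2$ every $q\in\mathbb Q$ above both $g_\ell(x_0,k_\ell)$ and $g_\ell(x_1,k_\ell)$ forces $\dot\tau_\ell\restriction n\in A_\ell$. **Proposition.** Let $(K,\Sigma)$ be a local, forgetful and complete creating pair for $\mathbf H$ such that $(\gamma)$ if $a\in A\subseteq\mathbf H(n)$, $A\setminus\{a\}\neq\emptyset$ and $\mathrm{nor}[t^n_A]>1$, then $\mathrm{nor}[t^n_{A\setminus\{a\}}]\ge\mathrm{nor}[t^n_A]-1$. In (1)–(3) suppose that $|\mathbf H(n)|>2^n$ for all $n$, $(\bar K,\bar g)$ is a 1-norming system, and $A_n=\mathbf H(n)\setminus\{g_\rho(n):\rho\in2^\ell\}$ for $n\in K_\ell$, $A_n=\mathbf H(n)$ for $n\notin\bigcup_\ell K_\ell$. In (4)–(5) let $\bar U$ be a 2-norming system. A function $f:\omega\times\omega\to\omega$ is *fast* if $f(k,\ell)\le f(k,\ell+1)$ and $2f(k,\ell)<f(k+1,\ell)$; $h:\omega\times\omega\to\omega$ is *regressive* if $1\le h(m,k)<k$ for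 $k>1$ and each $h(m,\cdot)$ is non-decreasing; $\mathcal F$ is *$h$-closed* if for every $f\in\mathcal F$ there is $f^*\in\mathcal F$ with $(\forall^\infty n)f^*(n)\le h(n,f(n))$, and *$\ge^*$-directed* if for all $f_0,f_1\in\mathcal F$ there is $f^*\in\mathcal F$ with $(\forall^\infty n)f^*(n)\le\min\{f_0(n),f_1(n)\}$. 1. If $(K,\Sigma)$ is linked and $\lim_n\mathrm{nor}[t^n_{A_n}]=\infty$, then $\mathbb Q^{\bar K,\bar g}_\infty$ is very explicitly sour over Cohen. 2. If moreover $f$ is fast and $f(n,i)\le\mathrm{nor}[t^i_{\mathbf H(i)}]$ for all $n$ and $i\ge n$, then $\mathbb Q^{\bar K,\bar g}_f$ is very explicitly sour over Cohen. 3. If $h$ is regressive, $\mathcal F\subseteq(\omega\setminus2)^\omega$ is nonempty, countable, $h$-closed and $\ge^*$-directed, $(K,\Sigma)$ is $h$-linked and $(\forall^\infty n)f(n)\le\mathrm{nor}[t^n_{A_n}]$ for each $f\in\mathcal F$, then $\mathbb Q^{\bar K,\bar g}_{\mathcal F}$ is very explicitly sour over Cohen. 4. If $(K,\Sigma)$ is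 linked and $\lim_n\mathrm{nor}[t^n_{\mathbf H(n)}]=\infty$, then $\mathbb Q^{\bar U}_\infty$ is very explicitly sour over Cohen. 5. If moreover (in addition to the assumptions of 4) $f$ is fast and $f(n,i)\le\mathrm{nor}[t^i_{\mathbf H(i)}]$ for all $n$ and $i\ge n$, then $\mathbb Q^{\bar U}_f$ is very explicitly sour over Cohen. If $h$ is regressive, $\mathcal F\subseteq(\omega\setminus2)^\omega$ is nonempty, countable, $h$-closed and $\ge^*$-directed, $(K,\Sigma)$ is $h$-linked and $f(n)\le\mathrm{nor}[t^n_{\mathbf H(n)}]$ for all $f\in\mathcal F$ and $n$, then $\mathbb Q^{\bar U}_{\mathcal F}$ is very explicitly sour over Cohen. In each case, if in addition the functions $A\mapsto\mathrm{nor}[t^n_A]$ ($\emptyset\ne A\subseteq\mathbf H(n)$) are Borel on $\mathcal P(\mathbf H(n))=2^{\mathbf H(n)}$ for every $n$ (which is automatic when all $\mathbf H(n)$ are finite), then the respective forcing notion is Souslin. -/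

import Mathlib

open Set Filter Topology

/-! ### Finite sequences -/

/-- A finite sequence `u ∈ ∏_{i < len} H i`. -/
@[ext] structure FinSeq (H : ℕ → Type*) where
  len : ℕ
  val : (i : Fin len) → H i

namespace FinSeq

variable {H : ℕ → Type*}

/-- `u ≤ v` : `u` is a (not necessarily proper) initial segment of `v`. -/
instance : Preorder (FinSeq H) where
  le u v := ∃ h : u.len ≤ v.len, ∀ i : Fin u.len, v.val (Fin.castLE h i) = u.val i
  le_refl u := ⟨le_refl _, fun _ => rfl⟩
  le_trans u v w := by
    rintro ⟨h, hu⟩ ⟨h', hv⟩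
    exact ⟨h.trans h', fun i => (hv (Fin.castLE h i)).trans (hu i)⟩

/-- The restriction `u ↾ m`. -/
def take (u : FinSeq H) (m : ℕ) : FinSeq H :=
  ⟨min m u.len, fun i => u.val (Fin.castLE (min_le_right _ _) i)⟩

/-- The finite sequences carry the discrete topology. -/
instance : TopologicalSpace (FinSeq H) := ⊥

instance : DiscreteTopology (FinSeq H) := ⟨rfl⟩

end FinSeq

/-- The restriction `x ↾ n` of an infinite sequence. -/
def restr {H : ℕ → Type*} (x : (n : ℕ) → H n) (n : ℕ) : FinSeq H := ⟨n, fun i => x i⟩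

/-- `ρ ◁ x` for a finite sequence `ρ` and an infinite sequence `x`. -/
def InitSeg {H : ℕ → Type*} (ρ : FinSeq H) (x : (n : ℕ) → H n) : Prop := restr x ρ.len = ρ

/-- `2^{<ω}`. -/
abbrev BinSeq : Type := FinSeq (fun _ : ℕ => Bool)

/-! ### Forcing notions (stronger conditions are larger) -/

section Forcing

variable {Q : Type*} [Preorder Q]

def Compat (p q : Q) : Prop := ∃ r, p ≤ r ∧ q ≤ r

def Predense (A : Set Q) : Prop := ∀ q : Q, ∃ a ∈ A, Compat a q

variable (Q) in
/-- The countable chain condition. -/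
def CCC : Prop := ∀ A : Set Q, A.Pairwise (fun p q => ¬ Compat p q) → A.Countable

variable (Q) in
/-- `RO(Q)`: the regular open subsets of `Q`, where the open sets are the sets closed under passing
to stronger conditions (so `q` is in the interior of the closure of `A` iff every `r ≥ q` has
some `s ≥ r` in `A`); ordered by inclusion. -/
def RO : Type _ := {A : Set Q // ∀ q, q ∈ A ↔ ∀ r, q ≤ r → ∃ s, r ≤ s ∧ s ∈ A}

namespace RO

instance : PartialOrder (RO Q) := inferInstanceAs (PartialOrder (Subtype _))

/-- The Boolean value of "the generic filter meets `D`". As a set, it is the collection of all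
conditions `p` which force that the generic filter meets `D`. -/
def meets (D : Set Q) : RO Q :=
  ⟨{p | ∀ r, p ≤ r → ∃ s, r ≤ s ∧ ∃ d ∈ D, d ≤ s}, by
    intro q
    constructor
    · intro h r hr
      exact ⟨r, le_refl r, fun r' hr' => h r' (hr.trans hr')⟩
    · intro h r hr
      obtain ⟨s, hs, hs'⟩ := h r hr
      obtain ⟨s', h1, h2⟩ := hs' s (le_refl s)
      exact ⟨s', hs.trans h1, h2⟩⟩

/-- The supremum of a family of elements of `RO(Q)`. -/
def sup (T : Set (RO Q)) : RO Q :=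
  ⟨{p | ∀ r, p ≤ r → ∃ s, r ≤ s ∧ ∃ a ∈ T, s ∈ a.1}, by
    intro q
    constructor
    · intro h r hr
      exact ⟨r, le_refl r, fun r' hr' => h r' (hr.trans hr')⟩
    · intro h r hr
      obtain ⟨s, hs, hs'⟩ := h r hr
      obtain ⟨s', h1, h2⟩ := hs' s (le_refl s)
      exact ⟨s', hs.trans h1, h2⟩⟩

/-- The Boolean complement in `RO(Q)`. -/
def compl (a : RO Q) : RO Q :=
  ⟨{p | ∀ r, p ≤ r → r ∉ a.1}, by
    intro q
    constructor
    · intro h r hr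
      exact ⟨r, le_refl r, fun r' hr' => h r' (hr.trans hr')⟩
    · intro h r hr hra
      obtain ⟨s, hs, hs'⟩ := h r hr
      refine hs' s (le_refl s) ((a.2 s).2 fun r' hr' => ?_)
      exact (a.2 r).1 hra r' (hs.trans hr')⟩

/-- The complete subalgebra of `RO(Q)` generated by `G`. -/
def generated (G : Set (RO Q)) : Set (RO Q) :=
  ⋂₀ {S | G ⊆ S ∧ (∀ T, T ⊆ S → sup T ∈ S) ∧ ∀ a ∈ S, compl a ∈ S}

end RO

variable (Q) in
/-- A standard `Q`-name `τ = ⟨q_{η,k} : k < N_η⟩` for an element of `∏_n H n`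
(`q_{η,k}` forces that `η` is an initial segment of `τ`). -/
structure StdName (H : ℕ → Type*) where
  N : FinSeq H → ℕ∞
  q : {x : FinSeq H × ℕ // (x.2 : ℕ∞) < N x.1} → Q
  antichain : ∀ x y, x.1.1.len = y.1.1.len → x ≠ y → ¬ Compat (q x) (q y)
  maximal : ∀ (n : ℕ) (p : Q), ∃ x, x.1.1.len = n ∧ Compat p (q x)
  mono : ∀ x, ∀ ν : FinSeq H, ν ≤ x.1.1 → ∃ y, y.1.1 = ν ∧ q y ≤ q x

namespace StdName

variable {H : ℕ → Type*}

/-- The Boolean value of `τ ↾ n ∈ A`. -/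
def boolVal (τ : StdName Q H) (n : ℕ) (A : Set ((i : Fin n) → H i)) : RO Q :=
  RO.meets {p | ∃ x, (∃ a ∈ A, x.1.1 = ⟨n, a⟩) ∧ τ.q x = p}

/-- `p ⊩ τ ↾ n ∈ A`. -/
def Forces (τ : StdName Q H) (p : Q) (n : ℕ) (A : Set ((i : Fin n) → H i)) : Prop :=
  p ∈ (τ.boolVal n A).1

/-- The Boolean value of `η ◁ τ`. -/
def initVal (τ : StdName Q H) (η : FinSeq H) : RO Q := τ.boolVal η.len {η.val}

end StdName

/-- Let `W = ⟨p_η⟩` be a `P`-name for a real (`p_η` forces that `η` is an initial segment of it).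
`SameGeneric W τ` says that there is an isomorphism from `RO(P)` onto the complete subalgebra of
`RO(Q)` generated by the Boolean values of `η ◁ τ`, which maps the Boolean value of `η ◁ W` to
that of `η ◁ τ` for every `η`. -/
def SameGeneric {P : Type*} [Preorder P] {H : ℕ → Type*} (W : FinSeq H → P)
    (τ : StdName Q H) : Prop :=
  ∃ f : RO P ≃o {a : RO Q // a ∈ RO.generated (Set.range τ.initVal)},
    ∀ η, (f (RO.meets {W η})).1 = τ.initVal η

/-- `(Q₀, τ₀)` is very explicitly sour to `(Q₁, τ₁)`. Conditions are coded as points of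
topological spaces by `c₀`, `c₁`, and Borel functions into `Q_ℓ` are understood via these codes. -/
def VeryExplicitlySour {H : ℕ → Type*} [∀ n, TopologicalSpace (H n)]
    {Q₀ Q₁ Y₀ Y₁ : Type*} [Preorder Q₀] [Preorder Q₁] [TopologicalSpace Y₀] [TopologicalSpace Y₁]
    (c₀ : Q₀ → Y₀) (τ₀ : StdName Q₀ H) (c₁ : Q₁ → Y₁) (τ₁ : StdName Q₁ H) : Prop :=
  ∃ (g₀ : ((n : ℕ) → H n) × ℕ → Q₀) (g₁ : ((n : ℕ) → H n) × ℕ → Q₁),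
    @Measurable _ _ (borel _) (borel _) (fun z => c₀ (g₀ z)) ∧
    @Measurable _ _ (borel _) (borel _) (fun z => c₁ (g₁ z)) ∧
    (∀ x, Predense (Set.range fun n => g₀ (x, n))) ∧
    (∀ x, Predense (Set.range fun n => g₁ (x, n))) ∧
    ∀ x₀ x₁ : (n : ℕ) → H n, x₀ ≠ x₁ → ∀ m k₀ k₁ : ℕ, restr x₀ m = restr x₁ m →
      k₀ < m → k₁ < m →
      ∃ (n : ℕ) (A₀ A₁ : Set ((i : Fin n) → H i)), Disjoint A₀ A₁ ∧
        (∀ q, g₀ (x₀, k₀) ≤ q → g₀ (x₁, k₀) ≤ q → τ₀.Forces q n A₀) ∧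
        (∀ q, g₁ (x₀, k₁) ≤ q → g₁ (x₁, k₁) ≤ q → τ₁.Forces q n A₁)

/-- The ccc forcing notion `Q` (with conditions coded by `c`) is very explicitly sour over
`(P, W)`. -/
def VeryExplicitlySourOver {P : Type*} [Preorder P] {H : ℕ → Type*} [∀ n, TopologicalSpace (H n)]
    (W : FinSeq H → P) {Y : Type*} [TopologicalSpace Y] (c : Q → Y) : Prop :=
  Function.Injective c ∧ CCC Q ∧
    ∃ τ₀ τ₁ : StdName Q H, SameGeneric W τ₀ ∧ SameGeneric W τ₁ ∧ VeryExplicitlySour c τ₀ c τ₁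

/-- `Q` (with conditions coded by `c`) is a Souslin forcing notion: the set of conditions, the order
and the incompatibility relation are `Σ¹₁`. -/
def IsSouslin {Y : Type*} [TopologicalSpace Y] (c : Q → Y) : Prop :=
  Function.Injective c ∧ MeasureTheory.AnalyticSet (Set.range c) ∧
    MeasureTheory.AnalyticSet {z : Y × Y | ∃ p q, p ≤ q ∧ (c p, c q) = z} ∧
    MeasureTheory.AnalyticSet {z : Y × Y | ∃ p q, ¬ Compat p q ∧ (c p, c q) = z}

end Forcing

/-- The Cohen forcing is `2^{<ω}` (longer sequences are stronger) and its generic real is the name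
`⟨p_η : η ∈ 2^{<ω}⟩` with `p_η = η`. -/
def cohenReal : BinSeq → BinSeq := id

/-! ### Creatures and creating pairs -/

/-- A creature `t = (nor[t], val[t], dis[t])` for `H`; the values of `dis` are from a set `D`. -/
structure Creature (H : ℕ → Type*) (D : Type*) where
  nor : ℝ
  nor_nonneg : 0 ≤ nor
  dis : D
  dn : ℕ
  up : ℕ
  dn_lt_up : dn < up
  val : Set (FinSeq H × FinSeq H)
  val_nonempty : val.Nonempty
  val_sub : ∀ u v, (u, v) ∈ val → u.len = dn ∧ v.len = up ∧ u ≤ v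

namespace Creature

variable {H : ℕ → Type*} {D : Type*}

/-- `dom(val[t])`. -/
def dom (t : Creature H D) : Set (FinSeq H) := {u | ∃ v, (u, v) ∈ t.val}

/-- The values at `i` of the sequences `v` with `⟨u, v⟩ ∈ val[t]`. For a creature `t` from a local
forgetful pair, `pos(t)` is this set for `i = dn`. -/
def pos (t : Creature H D) (i : ℕ) : Set (H i) :=
  {a | ∃ u v, (u, v) ∈ t.val ∧ ∃ h : i < v.len, v.val ⟨i, h⟩ = a}

/-- `pos(w, t_0, …, t_n)`. -/
def posSeq (w : FinSeq H) (t : ℕ → Creature H D) (n : ℕ) : Set (FinSeq H) :=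
  {v | v.len = (t n).up ∧ w < v ∧ ∀ i ≤ n, (v.take (t i).dn, v.take (t i).up) ∈ (t i).val}

end Creature

/-- A creating pair `(K, Σ)` for `H`. The operation `comp` (written `Σ` in the comments) is only
relevant on finite subsets of `K`; `Σ(t_0, …, t_k)` is `comp (t '' Iic k)`. -/
structure CreatingPair (H : ℕ → Type*) (D : Type*) where
  K : Set (Creature H D)
  comp : Set (Creature H D) → Set (Creature H D)
  comp_sub : ∀ S, S.Finite → S ⊆ K → comp S ⊆ K
  comp_empty : comp ∅ = ∅
  self_mem : ∀ t ∈ K, t ∈ comp {t}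
  enum : ∀ S, S.Finite → S ⊆ K → (comp S).Nonempty →
    ∃ (k : ℕ) (t : ℕ → Creature H D), S = t '' Iic k ∧ ∀ i < k, (t i).up = (t (i + 1)).dn
  dn_up : ∀ (k : ℕ) (t : ℕ → Creature H D), (∀ i ≤ k, t i ∈ K) →
    (∀ i < k, (t i).up = (t (i + 1)).dn) →
    ∀ s ∈ comp (t '' Iic k), s.dn = (t 0).dn ∧ s.up = (t k).up
  trans : ∀ (n : ℕ) (s : ℕ → Creature H D) (T : ℕ → Set (Creature H D)),
    (∀ i ≤ n, (T i).Finite ∧ T i ⊆ K ∧ s i ∈ comp (T i)) →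
    (∀ i < n, (s i).up = (s (i + 1)).dn) →
    comp (s '' Iic n) ⊆ comp (⋃ i ∈ Iic n, T i)
  nice : ∀ (k : ℕ) (t : ℕ → Creature H D), (∀ i ≤ k, t i ∈ K) →
    (∀ i < k, (t i).up = (t (i + 1)).dn) →
    ∀ s ∈ comp (t '' Iic k), (t 0).dom = s.dom ∧
      ∀ u v, (u, v) ∈ s.val → ∀ i ≤ k, (v.take (t i).dn, v.take (t i).up) ∈ (t i).val

namespace CreatingPair

variable {H : ℕ → Type*} {D : Type*} (C : CreatingPair H D)

def Local : Prop := ∀ t ∈ C.K, t.up = t.dn + 1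

def Forgetful : Prop :=
  ∀ t ∈ C.K, ∀ u v, (u, v) ∈ t.val → ∀ w v' : FinSeq H, w.len = t.dn → v'.len = t.up → w ≤ v' →
    (∀ (i : ℕ) (h : i < v.len) (h' : i < v'.len), t.dn ≤ i → v'.val ⟨i, h'⟩ = v.val ⟨i, h⟩) →
    (w, v') ∈ t.val

/-- Completeness of a (local forgetful) pair: for every nonempty `A ⊆ H i` there is a unique creature
`t^i_A ∈ K` with `dn = i` and `pos = A`, and if `A ⊆ B` then `t^i_A ∈ Σ(t^i_B)` and
`nor[t^i_A] ≤ nor[t^i_B]`. -/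
def Complete : Prop :=
  (∀ (i : ℕ) (A : Set (H i)), A.Nonempty → ∃! t, t ∈ C.K ∧ t.dn = i ∧ t.pos i = A) ∧
  ∀ (i : ℕ), ∀ s ∈ C.K, ∀ t ∈ C.K, s.dn = i → t.dn = i → s.pos i ⊆ t.pos i →
    s ∈ C.comp {t} ∧ s.nor ≤ t.nor

def Linked : Prop :=
  ∀ t₀ ∈ C.K, ∀ t₁ ∈ C.K, 1 < t₀.nor → 1 < t₁.nor → t₀.dn = t₁.dn → t₀.up = t₁.up →
    ∃ s ∈ C.comp {t₀} ∩ C.comp {t₁}, min t₀.nor t₁.nor - 1 ≤ s.nor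

/-- `h`-linked pairs. -/
def HLinked (h : ℕ → ℕ → ℕ) : Prop :=
  ∀ k : ℕ, 1 < k → ∀ t₀ ∈ C.K, ∀ t₁ ∈ C.K, (k : ℝ) ≤ t₀.nor → (k : ℝ) ≤ t₁.nor →
    t₀.dn = t₁.dn → t₀.up = t₁.up →
    ∃ s ∈ C.comp {t₀} ∩ C.comp {t₁}, (h t₀.dn k : ℝ) ≤ s.nor

open Classical in
/-- `nor[t^i_A]` for a complete pair and a nonempty set `A ⊆ H i`. -/
noncomputable def norAt (i : ℕ) (A : Set (H i)) : ℝ :=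
  if h : ∃ t, t ∈ C.K ∧ t.dn = i ∧ t.pos i = A then h.choose.nor else 0

/-- For every `n`, the function `A ↦ nor[t^n_A]` on the Cantor space `𝒫(H n) = 2^{H n}` is Borel. -/
def BorelNorms : Prop :=
  ∀ n, @Measurable (H n → Bool) ℝ (borel _) (borel _) fun χ => C.norAt n {a | χ a = true}

/-! ### The forcing notions -/

/-- Conditions `(w, t_0, t_1, …)` with no demand on the norms. -/
structure Cond where
  w : FinSeq H
  t : ℕ → Creature H D
  mem : ∀ i, t i ∈ C.K
  chain : ∀ i, (t i).up = (t (i + 1)).dn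
  w_dom : w ∈ (t 0).dom
  pos_dom : ∀ i, Creature.posSeq w t i ⊆ (t (i + 1)).dom

variable {C} in
/-- `q` is a result of deciding the value for `p`. -/
def Decides (p q : C.Cond) : Prop :=
  (q.w = p.w ∧ q.t = p.t) ∨
    ∃ n, q.w ∈ Creature.posSeq p.w p.t n ∧ ∀ i, q.t i = p.t (n + 1 + i)

variable {C} in
/-- `q` is a result of applying `Σ` to `p`. -/
def AppliesComp (p q : C.Cond) : Prop :=
  q.w = p.w ∧ ∃ n : ℕ → ℕ, n 0 = 0 ∧ StrictMono n ∧
    ∀ i, q.t i ∈ C.comp (p.t '' Ico (n i) (n (i + 1)))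

instance : Preorder C.Cond where
  le := Relation.ReflTransGen fun p q => Decides p q ∨ AppliesComp p q
  le_refl _ := Relation.ReflTransGen.refl
  le_trans _ _ _ := Relation.ReflTransGen.trans

/-- The forcing notion determined by `(K, Σ)` and a norm condition `N`. -/
def Forcing (N : Set (ℕ → Creature H D)) : Type _ := {p : C.Cond // p.t ∈ N}

instance (N : Set (ℕ → Creature H D)) : Preorder (C.Forcing N) :=
  Preorder.lift (Subtype.val : {p : C.Cond // p.t ∈ N} → C.Cond)

open Classical in
/-- The real coding a condition: the sequence `w`, and for each `n` the (characteristic function of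
the) set `pos(t_i) ⊆ H n` for the `i` such that `t_i` has `dn = n` (the empty set if there is no
such `i`). For local forgetful complete pairs this determines the condition. -/
noncomputable def code (N : Set (ℕ → Creature H D)) (p : C.Forcing N) :
    FinSeq H × ((n : ℕ) → H n → Bool) :=
  (p.1.w, fun n a => decide (∃ i, (p.1.t i).dn = n ∧ a ∈ (p.1.t i).pos n))

end CreatingPair

/-! ### Norm conditions -/

section NormConditions

variable {H : ℕ → Type*} {D : Type*}

def normInf : Set (ℕ → Creature H D) := {t | Tendsto (fun i => (t i).nor) atTop atTop}

def normFun (f : ℕ → ℕ → ℕ) : Set (ℕ → Creature H D) :=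
  {t | ∀ n, ∀ᶠ i in atTop, (f n (t i).dn : ℝ) ≤ (t i).nor}

def normFam (F : Set (ℕ → ℕ)) : Set (ℕ → Creature H D) :=
  {t | ∃ f ∈ F, ∀ᶠ i in atTop, (f (t i).dn : ℝ) ≤ (t i).nor}

def Fast (f : ℕ → ℕ → ℕ) : Prop := ∀ k l, f k l ≤ f k (l + 1) ∧ 2 * f k l < f (k + 1) l

def Regressive (h : ℕ → ℕ → ℕ) : Prop :=
  ∀ m, (∀ k, 1 < k → 1 ≤ h m k ∧ h m k < k) ∧ ∀ k l, k < l → h m k ≤ h m l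

def HClosed (h : ℕ → ℕ → ℕ) (F : Set (ℕ → ℕ)) : Prop :=
  ∀ f ∈ F, ∃ f' ∈ F, ∀ᶠ n in atTop, f' n ≤ h n (f n)

/-- `≥*`-directed families. -/
def GeDirected (F : Set (ℕ → ℕ)) : Prop :=
  ∀ f₀ ∈ F, ∀ f₁ ∈ F, ∃ f ∈ F, ∀ᶠ n in atTop, f n ≤ min (f₀ n) (f₁ n)

/-- 1-norming systems `(⟨K_ℓ⟩, ⟨g_ρ⟩)`; only the values `g_ρ(m)` for `m ∈ K_{lh ρ}` matter. -/
structure IsOneNorming (K : ℕ → Set ℕ) (g : BinSeq → (m : ℕ) → H m) : Prop where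
  infinite : ∀ l, (K l).Infinite
  disjoint : Pairwise fun l l' => Disjoint (K l) (K l')
  le_min : ∀ l, ∀ m ∈ K l, l ≤ m
  inj : ∀ l, ∀ m ∈ K l, ∀ ρ ρ' : BinSeq, ρ.len = l → ρ'.len = l → g ρ m = g ρ' m → ρ = ρ'

/-- The `(K̄, ḡ)`-modified version of the norm condition `N`. -/
def modK (K : ℕ → Set ℕ) (g : BinSeq → (m : ℕ) → H m) (N : Set (ℕ → Creature H D)) :
    Set (ℕ → Creature H D) :=
  {t | t ∈ N ∧ ∃ R : Set (ℕ → Bool), R.Finite ∧ ∀ (i : ℕ) (ρ : BinSeq),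
    (t i).dn ∈ K ρ.len → g ρ (t i).dn ∉ (t i).pos (t i).dn → ∃ x ∈ R, InitSeg ρ x}

/-- `A_n = H n ∖ {g_ρ(n) : ρ ∈ 2^ℓ}` if `n ∈ K_ℓ`, and `A_n = H n` if `n ∉ ⋃_ℓ K_ℓ`. -/
def avoidSet (K : ℕ → Set ℕ) (g : BinSeq → (m : ℕ) → H m) (n : ℕ) : Set (H n) :=
  {a | ∀ ρ : BinSeq, n ∈ K ρ.len → a ≠ g ρ n}

/-- 2-norming systems `⟨U_{ρ,k}⟩`. -/
structure IsTwoNorming (U : BinSeq → ℕ → Set ℕ) : Prop where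
  infinite : ∀ ρ k, (U ρ k).Infinite
  disjoint : Pairwise fun x y : BinSeq × ℕ => Disjoint (U x.1 x.2) (U y.1 y.2)
  le_min : ∀ ρ k, ∀ m ∈ U ρ k, ρ.len ≤ m

/-- The `Ū`-modified version of the norm condition `N`. -/
def modU (U : BinSeq → ℕ → Set ℕ) (N : Set (ℕ → Creature H D)) : Set (ℕ → Creature H D) :=
  {t | t ∈ N ∧ ∃ (R : Set (ℕ → Bool)) (S : Set ℕ), R.Finite ∧ S.Finite ∧
    ∀ (i k : ℕ) (ρ : BinSeq), (t i).dn ∈ U ρ k → (t i).pos (t i).dn ≠ Set.univ →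
      (∃ x ∈ R, InitSeg ρ x) ∧ k ∈ S}

end NormConditions

/-! A local forgetful complete pair has exactly one creature per nonempty set of values. A condition
is therefore a stem together with a slalom, that is, nonempty sets S(n) of allowed values past the
stem; a stronger condition extends the stem through the slalom and shrinks the slalom
(`le_iff_slalomLE`, `isSlalom`). The norms then enter only through two lists of properties.
`NormBase` covers the basic norm conditions: closure under intersections, room to omit one point per
coordinate, σ-linkedness. `BranchNorm` covers a norming system: it yields distinct positions pos(ρ)
≥ lh(ρ) and points a_ρ at them such that a slalom may omit all a_ρ with ρ ◁ x for a single real x,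
while for each condition and each long enough σ, some a_{σ⌢b} at a position past the stem is still
allowed. The latter holds because the exceptions lie on finitely many branches, and finitely many
reals do not split above some level.

Call σ hit if the generic sequence passes through a_{σ⌢0} or a_{σ⌢1}. Along an enumeration of
2^{<ω}, the name τ₀ records which σ are hit, and τ₁ is its bitwise negation. Below a given
condition, from some index on, every σ can still be hit, and it can still be missed because
large-norm sets survive the removal of a point. So all later bits are free and both names are Cohen
(`exists_bits_eq`, `sameGeneric_cohenReal`).

For sourness, g₀ = g₁ = g, where g(x,k) has the k-th stem and omits a_ρ for ρ ◁ x. If x₀, x₁ split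
at σ, a condition above g(x₀,k) and g(x₁,k) omits both a_{σ⌢0} and a_{σ⌢1}, so σ is not hit: its bit
is false in τ₀ and true in τ₁ (`veryExplicitlySourOver`).

Compatibility reduces to coordinatewise nonemptiness of intersections (`compat_iff`). This gives
ccc, and it makes order and incompatibility Borel relative to the set of codes; quantifying over the
finite set of branches keeps that set analytic (`isSouslin`). -/

open MeasureTheory

/-! ### Finite sequences and branches of the binary tree -/

namespace FinSeq

variable {H : ℕ → Type*}

theorem le_def {u v : FinSeq H} : u ≤ v ↔
    u.len ≤ v.len ∧ ∀ i (h : i < u.len) (h' : i < v.len), v.val ⟨i, h'⟩ = u.val ⟨i, h⟩ := by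
  constructor
  · rintro ⟨h, hv⟩
    exact ⟨h, fun i hi _ => hv ⟨i, hi⟩⟩
  · rintro ⟨h, hv⟩
    exact ⟨h, fun i => hv i i.2 _⟩

theorem ext_of_forall {u v : FinSeq H} (h : u.len = v.len)
    (hv : ∀ i (h : i < u.len) (h' : i < v.len), v.val ⟨i, h'⟩ = u.val ⟨i, h⟩) : u = v := by
  obtain ⟨n, u⟩ := u
  obtain ⟨m, v⟩ := v
  obtain rfl : n = m := h
  congr 1
  funext i
  exact (hv i i.2 i.2).symm

theorem eq_of_le_of_len_le {u v : FinSeq H} (h : u ≤ v) (hl : v.len ≤ u.len) : u = v :=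
  ext_of_forall (le_antisymm (le_def.1 h).1 hl) (le_def.1 h).2

theorem lt_iff {u v : FinSeq H} : u < v ↔ u ≤ v ∧ u.len < v.len := by
  rw [lt_iff_le_not_ge]
  refine and_congr_right fun h => ⟨fun h' => ?_, fun h' h'' => absurd (le_def.1 h'').1 (by omega)⟩
  by_contra hl
  exact h' (eq_of_le_of_len_le h (by omega)).ge

theorem take_len {u : FinSeq H} {m : ℕ} (h : m ≤ u.len) : (u.take m).len = m :=
  min_eq_left h

theorem take_eq_self {u : FinSeq H} {m : ℕ} (h : u.len ≤ m) : u.take m = u :=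
  ext_of_forall (min_eq_right h) fun _ _ _ => rfl

theorem take_le (u : FinSeq H) (m : ℕ) : u.take m ≤ u :=
  le_def.2 ⟨min_le_right _ _, fun _ _ _ => rfl⟩

theorem take_le_take (u : FinSeq H) {m n : ℕ} (h : m ≤ n) : u.take m ≤ u.take n :=
  le_def.2 ⟨min_le_min_right _ h, fun _ _ _ => rfl⟩

theorem take_of_le {u v : FinSeq H} (h : u ≤ v) : v.take u.len = u :=
  ext_of_forall (take_len (le_def.1 h).1) fun i _ hi' =>
    ((le_def.1 h).2 i hi' (hi'.trans_le (le_def.1 h).1)).symm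

theorem le_total_of_le {u v w : FinSeq H} (hu : u ≤ w) (hv : v ≤ w) (h : u.len ≤ v.len) :
    u ≤ v :=
  le_def.2 ⟨h, fun i hi hi' => by
    rw [← (le_def.1 hu).2 i hi (hi.trans_le (le_def.1 hu).1),
      ← (le_def.1 hv).2 i hi' (hi.trans_le (le_def.1 hu).1)]⟩

theorem restr_le_restr (x : (n : ℕ) → H n) {m n : ℕ} (h : m ≤ n) : restr x m ≤ restr x n :=
  le_def.2 ⟨h, fun _ _ _ => rfl⟩

theorem exists_restr_eq [∀ n, Nonempty (H n)] (u : FinSeq H) :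
    ∃ x : (n : ℕ) → H n, restr x u.len = u := by
  classical
  refine ⟨fun n => if h : n < u.len then u.val ⟨n, h⟩ else Classical.arbitrary _, ?_⟩
  refine ext_of_forall rfl fun i hi hi' => ?_
  simp [restr, hi']

instance [∀ n, Countable (H n)] : Countable (FinSeq H) := by
  have : Function.Injective
      (fun u : FinSeq H => (⟨u.len, u.val⟩ : Σ n : ℕ, (i : Fin n) → H i)) := by
    rintro ⟨n, u⟩ ⟨m, v⟩ h
    obtain ⟨rfl, h⟩ := Sigma.mk.inj h
    obtain rfl := eq_of_heq h
    rfl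
  exact this.countable

instance : Infinite BinSeq :=
  Infinite.of_injective (fun n => (restr (fun _ => false) n : BinSeq))
    fun _ _ h => congrArg FinSeq.len h

theorem finite_len_lt (n : ℕ) : {σ : BinSeq | σ.len < n}.Finite := by
  have : Finite (Σ m : Fin n, (Fin m → Bool)) := inferInstance
  refine (Set.finite_range (fun u : Σ m : Fin n, (Fin m → Bool) => (⟨u.1, u.2⟩ : BinSeq))).subset ?_
  intro σ hσ
  exact ⟨⟨⟨σ.len, hσ⟩, σ.val⟩, rfl⟩

/-- The sequence `σ⌢b`. -/
def snoc (σ : BinSeq) (b : Bool) : BinSeq :=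
  ⟨σ.len + 1, fun i => if h : i.1 < σ.len then σ.val ⟨i, h⟩ else b⟩

theorem initSeg_iff {ρ : FinSeq H} {x : (n : ℕ) → H n} :
    InitSeg ρ x ↔ ∀ i (h : i < ρ.len), x i = ρ.val ⟨i, h⟩ := by
  constructor
  · intro h i hi
    have := h.ge
    exact (le_def.1 this).2 i hi hi
  · intro h
    exact ext_of_forall rfl fun i hi hi' => (h i hi').symm

theorem initSeg_snoc {σ : BinSeq} {b : Bool} {x : ℕ → Bool} :
    InitSeg (snoc σ b) x ↔ InitSeg σ x ∧ x σ.len = b := by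
  simp only [initSeg_iff]
  constructor
  · intro h
    refine ⟨fun i hi => ?_, ?_⟩
    · have := h i (Nat.lt_succ_of_lt hi)
      simpa [snoc, hi] using this
    · have := h σ.len (Nat.lt_succ_self _)
      simpa [snoc] using this
  · rintro ⟨h, hb⟩ i hi
    rcases Nat.lt_succ_iff_lt_or_eq.1 hi with hi' | rfl
    · simpa [snoc, hi'] using h i hi'
    · simpa [snoc] using hb

theorem snoc_injective {σ τ : BinSeq} {b c : Bool} (h : snoc σ b = snoc τ c) : σ = τ ∧ b = c := by
  have hl : σ.len = τ.len := Nat.succ_injective (congrArg FinSeq.len h)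
  have h1 := (le_def.1 h.le).2
  constructor
  · refine ext_of_forall hl fun i hi hi' => ?_
    have := h1 i (Nat.lt_succ_of_lt hi) (Nat.lt_succ_of_lt hi')
    simpa [snoc, hi, hi'] using this
  · have := h1 σ.len (Nat.lt_succ_self _) (by simp [snoc, hl])
    simpa [snoc, hl] using this.symm

/-- Two members of a finite set of reals which agree for long are equal. -/
theorem exists_forall_not_initSeg_snoc {R : Set (ℕ → Bool)} (hR : R.Finite) :
    ∃ M, ∀ σ : BinSeq, M ≤ σ.len → ∃ b, ∀ x ∈ R, ¬ InitSeg (snoc σ b) x := by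
  have : ∀ x ∈ R, ∀ y ∈ R, ∃ M, x ≠ y → ∃ i < M, x i ≠ y i := by
    intro x _ y _
    by_cases h : x = y
    · exact ⟨0, fun h' => absurd h h'⟩
    · obtain ⟨i, hi⟩ := Function.ne_iff.1 h
      exact ⟨i + 1, fun _ => ⟨i, Nat.lt_succ_self i, hi⟩⟩
  choose! F hF using this
  have hfin : ((fun z : (ℕ → Bool) × (ℕ → Bool) => F z.1 z.2) '' (R ×ˢ R)).Finite :=
    (hR.prod hR).image _
  -- `M` bounds the splitting levels of all pairs from `R`. Members of `R` through σ⌢0 and σ⌢1 would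
  -- agree below lh(σ) ≥ M and yet differ at lh(σ).
  obtain ⟨M, hM⟩ := hfin.bddAbove
  refine ⟨M, fun σ hσ => ?_⟩
  by_contra! hcon
  obtain ⟨x, hx, hx'⟩ := hcon false
  obtain ⟨y, hy, hy'⟩ := hcon true
  rw [initSeg_snoc] at hx' hy'
  have hne : x ≠ y := by
    rintro rfl
    simp [hx'.2] at hy'
  obtain ⟨i, hi, hxy⟩ := hF x hx y hy hne
  have hi' : i < σ.len := (hi.trans_le (hM ⟨(x, y), ⟨hx, hy⟩, rfl⟩)).trans_le hσ
  exact hxy ((initSeg_iff.1 hx'.1 i hi').trans (initSeg_iff.1 hy'.1 i hi').symm)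

end FinSeq

/-- `Q` is the forcing notion whose conditions `p` consist of a finite sequence `w p` and nonempty
sets `S p n ⊆ H n` for `n ≥ lh(w p)` such that `S p ∈ T (lh(w p))`. -/
structure IsSlalom {H : ℕ → Type*} {Q : Type*} [Preorder Q] (w : Q → FinSeq H)
    (S : Q → (n : ℕ) → Set (H n)) (T : ℕ → Set ((n : ℕ) → Set (H n))) : Prop where
  le_iff : ∀ p q, p ≤ q ↔ w p ≤ w q ∧
    (∀ n (h : n < (w q).len), (w p).len ≤ n → (w q).val ⟨n, h⟩ ∈ S p n) ∧
    ∀ n, (w q).len ≤ n → S q n ⊆ S p n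
  nonempty : ∀ p n, (w p).len ≤ n → (S p n).Nonempty
  empty : ∀ p n, n < (w p).len → S p n = ∅
  mem : ∀ p, S p ∈ T (w p).len
  exists_mk : ∀ (u : FinSeq H) (A : (n : ℕ) → Set (H n)), A ∈ T u.len →
    (∀ n, u.len ≤ n → (A n).Nonempty) → ∃ p, w p = u ∧ ∀ n, u.len ≤ n → S p n = A n

/-! ### Conditions of local forgetful complete pairs as slaloms -/

namespace CreatingPair

variable {H : ℕ → Type*} {D : Type*} {C : CreatingPair H D}

theorem image_Iic_zero {α : Type*} (t : ℕ → α) : t '' Iic 0 = {t 0} := by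
  ext s
  simp [eq_comm]

theorem image_Ico_add_one {α : Type*} (t : ℕ → α) (i : ℕ) : t '' Ico i (i + 1) = {t i} := by
  have : Ico i (i + 1) = {i} := by
    ext j
    rw [mem_Ico, mem_singleton_iff]
    omega
  rw [this, image_singleton]

theorem mem_K_of_mem_comp {s t : Creature H D} (ht : t ∈ C.K) (hs : s ∈ C.comp {t}) : s ∈ C.K :=
  C.comp_sub {t} (finite_singleton t) (singleton_subset_iff.2 ht) hs

theorem dn_of_mem_comp {s t : Creature H D} (ht : t ∈ C.K) (hs : s ∈ C.comp {t}) :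
    s.dn = t.dn :=
  (C.dn_up 0 (fun _ => t) (fun _ _ => ht) (fun _ h => absurd h (by omega)) s
    (by rwa [image_Iic_zero])).1

theorem pos_subset_of_mem_comp (hl : C.Local) {s t : Creature H D} (ht : t ∈ C.K)
    (hs : s ∈ C.comp {t}) : s.pos t.dn ⊆ t.pos t.dn := by
  rintro a ⟨u, v, huv, h, rfl⟩
  have hv := (C.nice 0 (fun _ => t) (fun _ _ => ht) (fun _ h => absurd h (by omega)) s
    (by rwa [image_Iic_zero])).2 u v huv 0 le_rfl
  have hup := hl t ht
  exact ⟨_, _, hv, by simp only [FinSeq.take]; omega, rfl⟩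

theorem pos_nonempty (hl : C.Local) {t : Creature H D} (ht : t ∈ C.K) :
    (t.pos t.dn).Nonempty := by
  obtain ⟨⟨u, v⟩, h⟩ := t.val_nonempty
  have h1 := (t.val_sub u v h).2.1
  have h2 := hl t ht
  exact ⟨v.val ⟨t.dn, by omega⟩, u, v, h, by omega, rfl⟩

/-- Locality leaves a single new coordinate and forgetfulness decouples its value from the initial
part, so `val` is determined by `pos`. -/
theorem mem_val_iff (hl : C.Local) (hf : C.Forgetful) {t : Creature H D} (ht : t ∈ C.K)
    {u v : FinSeq H} : (u, v) ∈ t.val ↔ u.len = t.dn ∧ v.len = t.dn + 1 ∧ u ≤ v ∧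
      ∀ n (h : n < v.len), n = t.dn → v.val ⟨n, h⟩ ∈ t.pos n := by
  have hup := hl t ht
  constructor
  · intro h
    obtain ⟨h1, h2, h3⟩ := t.val_sub u v h
    exact ⟨h1, by omega, h3, fun _ h' _ => ⟨u, v, h, h', rfl⟩⟩
  · rintro ⟨h1, h2, h3, h4⟩
    obtain ⟨u', v', hv', h', he⟩ := h4 t.dn (by omega) rfl
    have h5 := (t.val_sub u' v' hv').2.1
    refine hf t ht u' v' hv' u v h1 (by omega) h3 fun i hi hi' hdn => ?_
    obtain rfl : i = t.dn := by omega
    exact he.symm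

theorem mem_dom_iff [∀ n, Nonempty (H n)] (hl : C.Local) (hf : C.Forgetful) {t : Creature H D}
    (ht : t ∈ C.K) {u : FinSeq H} : u ∈ t.dom ↔ u.len = t.dn := by
  constructor
  · rintro ⟨v, hv⟩
    exact (t.val_sub u v hv).1
  · intro hu
    classical
    obtain ⟨a, ha⟩ := pos_nonempty hl ht
    obtain ⟨x, hx⟩ := FinSeq.exists_restr_eq u
    refine ⟨restr (Function.update x t.dn a) (t.dn + 1), ?_⟩
    rw [mem_val_iff hl hf ht]
    refine ⟨hu, rfl, ?_, fun n h hn => by subst hn; simpa [restr] using ha⟩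
    rw [← hx]
    refine FinSeq.le_def.2 ⟨by simp only [restr]; omega, fun i h h' => ?_⟩
    have : i ≠ t.dn := by simp only [restr] at h; omega
    simp [restr, Function.update_of_ne this]

/-! ### Norms of the creatures -/

theorem norAt_eq (hc : C.Complete) {t : Creature H D} (ht : t ∈ C.K) {n : ℕ} (hn : t.dn = n)
    (hA : (t.pos n).Nonempty) : C.norAt n (t.pos n) = t.nor := by
  have h : ∃ s, s ∈ C.K ∧ s.dn = n ∧ s.pos n = t.pos n := ⟨t, ht, hn, rfl⟩
  rw [norAt, dif_pos h, (hc.1 n _ hA).unique h.choose_spec ⟨ht, hn, rfl⟩]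

theorem norAt_empty (hl : C.Local) (n : ℕ) : C.norAt n ∅ = 0 := by
  rw [norAt, dif_neg]
  rintro ⟨t, ht, rfl, h⟩
  exact (pos_nonempty hl ht).ne_empty h

theorem norAt_nonneg (n : ℕ) (A : Set (H n)) : 0 ≤ C.norAt n A := by
  rw [norAt]
  split_ifs
  · exact Creature.nor_nonneg _
  · exact le_rfl

/-- The default value 0 of `norAt` at the empty set makes a positive norm a certificate of
nonemptiness; this is how linkedness produces nonempty intersections. -/
theorem nonempty_of_norAt_pos (hl : C.Local) {n : ℕ} {A : Set (H n)} (h : 0 < C.norAt n A) :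
    A.Nonempty := by
  rw [nonempty_iff_ne_empty]
  rintro rfl
  exact h.ne' (norAt_empty hl n)

theorem norAt_mono (hl : C.Local) (hc : C.Complete) {n : ℕ} {A B : Set (H n)} (h : A ⊆ B) :
    C.norAt n A ≤ C.norAt n B := by
  rcases A.eq_empty_or_nonempty with rfl | hA
  · rw [norAt_empty hl]
    exact norAt_nonneg n B
  obtain ⟨s, ⟨hs, hsn, rfl⟩, -⟩ := hc.1 n A hA
  obtain ⟨t, ⟨ht, htn, rfl⟩, -⟩ := hc.1 n B (hA.mono h)
  rw [norAt_eq hc hs hsn hA, norAt_eq hc ht htn (hA.mono h)]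
  exact (hc.2 n s hs t ht hsn htn h).2

/-- The values of a common successor lie in both sets, so monotonicity of the norm turns linkedness
of creatures into an estimate for the intersection. -/
theorem nor_le_norAt_inter (hl : C.Local) (hc : C.Complete) {s t₀ t₁ : Creature H D} {n : ℕ}
    (h₀ : t₀ ∈ C.K) (h₁ : t₁ ∈ C.K) (hn₀ : t₀.dn = n) (hn₁ : t₁.dn = n)
    (hs : s ∈ C.comp {t₀} ∩ C.comp {t₁}) : s.nor ≤ C.norAt n (t₀.pos n ∩ t₁.pos n) := by
  subst hn₀
  have hsK := mem_K_of_mem_comp h₀ hs.1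
  have hsn := dn_of_mem_comp h₀ hs.1
  have hne : (s.pos t₀.dn).Nonempty := hsn ▸ pos_nonempty hl hsK
  rw [← norAt_eq hc hsK hsn hne]
  exact norAt_mono hl hc (subset_inter (pos_subset_of_mem_comp hl h₀ hs.1)
    (hn₁ ▸ pos_subset_of_mem_comp hl h₁ hs.2))

theorem Linked.norAt_inter (hl : C.Local) (hc : C.Complete) (h : C.Linked) {n : ℕ}
    {A B : Set (H n)} (hA : 1 < C.norAt n A) (hB : 1 < C.norAt n B) :
    min (C.norAt n A) (C.norAt n B) - 1 ≤ C.norAt n (A ∩ B) := by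
  have hA' := nonempty_of_norAt_pos hl (zero_lt_one.trans hA)
  have hB' := nonempty_of_norAt_pos hl (zero_lt_one.trans hB)
  obtain ⟨s, ⟨hs, hsn, rfl⟩, -⟩ := hc.1 n A hA'
  obtain ⟨t, ⟨ht, htn, rfl⟩, -⟩ := hc.1 n B hB'
  rw [norAt_eq hc hs hsn hA', norAt_eq hc ht htn hB'] at *
  obtain ⟨r, hr, hr'⟩ := h s hs t ht hA hB (by omega) (by rw [hl s hs, hl t ht, hsn, htn])
  exact hr'.trans (nor_le_norAt_inter hl hc hs ht hsn htn hr)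

theorem HLinked.norAt_inter (hl : C.Local) (hc : C.Complete) {h : ℕ → ℕ → ℕ} (hh : C.HLinked h)
    {n k : ℕ} (hk : 1 < k) {A B : Set (H n)} (hA : k ≤ C.norAt n A) (hB : k ≤ C.norAt n B) :
    h n k ≤ C.norAt n (A ∩ B) := by
  have hk0 : (0 : ℝ) < k := by exact_mod_cast zero_lt_one.trans hk
  have hA' := nonempty_of_norAt_pos hl (hk0.trans_le hA)
  have hB' := nonempty_of_norAt_pos hl (hk0.trans_le hB)
  obtain ⟨s, ⟨hs, hsn, rfl⟩, -⟩ := hc.1 n A hA'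
  obtain ⟨t, ⟨ht, htn, rfl⟩, -⟩ := hc.1 n B hB'
  rw [norAt_eq hc hs hsn hA'] at hA
  rw [norAt_eq hc ht htn hB'] at hB
  obtain ⟨r, hr, hr'⟩ := hh k hk s hs t ht hA hB (by omega) (by rw [hl s hs, hl t ht, hsn, htn])
  rw [hsn] at hr'
  exact hr'.trans (nor_le_norAt_inter hl hc hs ht hsn htn hr)

/-! ### Conditions -/

namespace Cond

theorem dn_t (p : C.Cond) (hl : C.Local) (i : ℕ) : (p.t i).dn = p.w.len + i := by
  induction i with
  | zero =>
    obtain ⟨v, hv⟩ := p.w_dom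
    exact ((p.t 0).val_sub _ _ hv).1.symm
  | succ i ih =>
    rw [← p.chain i, hl _ (p.mem i), ih]
    rfl

/-- The set of possible values at `n` of a condition. -/
def slalom (p : C.Cond) (n : ℕ) : Set (H n) := {a | ∃ i, (p.t i).dn = n ∧ a ∈ (p.t i).pos n}

theorem slalom_of_lt (p : C.Cond) (hl : C.Local) {n : ℕ} (hn : n < p.w.len) :
    p.slalom n = ∅ := by
  rw [eq_empty_iff_forall_notMem]
  rintro a ⟨i, hi, -⟩
  rw [p.dn_t hl] at hi
  omega

theorem slalom_of_dn (p : C.Cond) (hl : C.Local) {n i : ℕ} (hn : (p.t i).dn = n) :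
    p.slalom n = (p.t i).pos n := by
  ext a
  constructor
  · rintro ⟨j, hj, ha⟩
    rw [p.dn_t hl] at hj hn
    obtain rfl : j = i := by omega
    exact ha
  · exact fun ha => ⟨i, hn, ha⟩

theorem slalom_nonempty (p : C.Cond) (hl : C.Local) {n : ℕ} (hn : p.w.len ≤ n) :
    (p.slalom n).Nonempty := by
  have h : (p.t (n - p.w.len)).dn = n := by rw [p.dn_t hl]; omega
  rw [p.slalom_of_dn hl h]
  have := pos_nonempty hl (p.mem (n - p.w.len))
  rwa [h] at this

theorem norAt_slalom (p : C.Cond) (hl : C.Local) (hc : C.Complete) (i : ℕ) :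
    C.norAt (p.w.len + i) (p.slalom (p.w.len + i)) = (p.t i).nor := by
  have h := p.slalom_nonempty hl (Nat.le_add_right p.w.len i)
  rw [p.slalom_of_dn hl (p.dn_t hl i)] at h ⊢
  exact norAt_eq hc (p.mem i) (p.dn_t hl i) h

theorem ext_of (hl : C.Local) (hc : C.Complete) {p q : C.Cond} (hw : p.w = q.w)
    (hS : p.slalom = q.slalom) : p = q := by
  have ht : p.t = q.t := by
    funext i
    have hp := p.dn_t hl i
    have hq := q.dn_t hl i
    rw [← hw] at hq
    have hne := p.slalom_nonempty hl (Nat.le_add_right p.w.len i)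
    refine (hc.1 (p.w.len + i) (p.slalom (p.w.len + i)) hne).unique
      ⟨p.mem i, hp, (p.slalom_of_dn hl hp).symm⟩ ⟨q.mem i, hq, ?_⟩
    rw [hS, q.slalom_of_dn hl hq]
  cases p
  cases q
  subst hw
  subst ht
  rfl

/-- A condition given by a finite sequence and a suitable sequence of creatures. -/
def mk' [∀ n, Nonempty (H n)] (hl : C.Local) (hf : C.Forgetful) (w : FinSeq H)
    (t : ℕ → Creature H D) (ht : ∀ i, t i ∈ C.K) (hdn : ∀ i, (t i).dn = w.len + i) : C.Cond where
  w := w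
  t := t
  mem := ht
  chain i := by rw [hl _ (ht i), hdn, hdn]; rfl
  w_dom := (mem_dom_iff hl hf (ht 0)).2 (hdn 0).symm
  pos_dom i v hv := (mem_dom_iff hl hf (ht _)).2 (by rw [hv.1, hl _ (ht i), hdn, hdn]; rfl)

theorem exists_eq [∀ n, Nonempty (H n)] (hl : C.Local) (hf : C.Forgetful) (hc : C.Complete)
    (w : FinSeq H) (A : (n : ℕ) → Set (H n)) (hA : ∀ n, w.len ≤ n → (A n).Nonempty) :
    ∃ p : C.Cond, p.w = w ∧ ∀ n, w.len ≤ n → p.slalom n = A n := by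
  choose t ht using fun i => (hc.1 (w.len + i) (A (w.len + i)) (hA _ (Nat.le_add_right _ _))).exists
  refine ⟨mk' hl hf w t (fun i => (ht i).1) (fun i => (ht i).2.1), rfl, fun n hn => ?_⟩
  obtain ⟨i, rfl⟩ := Nat.exists_eq_add_of_le hn
  rw [slalom_of_dn _ hl (i := i)]
  · exact (ht i).2.2
  · exact (ht i).2.1

theorem mem_posSeq_iff (p : C.Cond) (hl : C.Local) (hf : C.Forgetful) {n : ℕ} {v : FinSeq H} :
    v ∈ Creature.posSeq p.w p.t n ↔ v.len = p.w.len + n + 1 ∧ p.w ≤ v ∧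
      ∀ m (h : m < v.len), p.w.len ≤ m → v.val ⟨m, h⟩ ∈ p.slalom m := by
  have hup : (p.t n).up = p.w.len + n + 1 := by rw [hl _ (p.mem n), p.dn_t hl]
  simp only [Creature.posSeq, mem_ofPred_eq, hup]
  refine and_congr_right fun hv => ?_
  rw [FinSeq.lt_iff, and_assoc]
  refine and_congr_right fun _ => ?_
  constructor
  · rintro ⟨-, h⟩ m hm hm'
    obtain ⟨i, rfl⟩ := Nat.exists_eq_add_of_le hm'
    have hdn := p.dn_t hl i
    have hup := hl _ (p.mem i)
    have h1 := (mem_val_iff hl hf (p.mem i)).1 (h i (by omega))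
    rw [p.slalom_of_dn hl (p.dn_t hl i)]
    exact h1.2.2.2 _ (by rw [FinSeq.take_len (by omega)]; omega) (p.dn_t hl i).symm
  · intro h
    refine ⟨by omega, fun i hi => ?_⟩
    have hdn := p.dn_t hl i
    rw [mem_val_iff hl hf (p.mem i)]
    have hup := hl _ (p.mem i)
    refine ⟨FinSeq.take_len (by omega), by rw [FinSeq.take_len (by omega), hup],
      FinSeq.take_le_take _ (by omega), fun m hm hmi => ?_⟩
    subst hmi
    rw [← p.slalom_of_dn hl rfl]
    exact h _ _ (by omega)

/-- The order of conditions in terms of the slaloms. -/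
def SlalomLE (p q : C.Cond) : Prop := p.w ≤ q.w ∧
    (∀ n (h : n < q.w.len), p.w.len ≤ n → q.w.val ⟨n, h⟩ ∈ p.slalom n) ∧
    ∀ n, q.w.len ≤ n → q.slalom n ⊆ p.slalom n

theorem SlalomLE.trans {p q r : C.Cond} (h : SlalomLE p q) (h' : SlalomLE q r) :
    SlalomLE p r := by
  obtain ⟨h1, h2, h3⟩ := h
  obtain ⟨k1, k2, k3⟩ := h'
  refine ⟨h1.trans k1, fun n hn hpn => ?_, fun n hn =>
    (k3 n hn).trans (h3 n ((FinSeq.le_def.1 k1).1.trans hn))⟩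
  rcases lt_or_ge n q.w.len with hq | hq
  · rw [(FinSeq.le_def.1 k1).2 n hq hn]
    exact h2 n hq hpn
  · exact h3 n hq (k2 n hn hq)

theorem slalomLE_of_decides (hl : C.Local) (hf : C.Forgetful) {p q : C.Cond}
    (h : Decides p q) : SlalomLE p q := by
  rcases h with ⟨hw, ht⟩ | ⟨n, hw, ht⟩
  · refine ⟨hw.ge, fun n h h' => by rw [hw] at h; omega, fun n _ => ?_⟩
    simp only [slalom, ht]
    exact subset_rfl
  · rw [mem_posSeq_iff p hl hf] at hw
    refine ⟨hw.2.1, hw.2.2, fun m hm a => ?_⟩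
    rintro ⟨i, hi, ha⟩
    rw [ht] at hi ha
    exact ⟨_, hi, ha⟩

theorem eq_self_of_succ {k : ℕ → ℕ} (hk : k 0 = 0) (h : ∀ i, k (i + 1) = k i + 1) (i : ℕ) :
    k i = i := by
  induction i with
  | zero => exact hk
  | succ i ih => rw [h, ih]

/-- A member of Σ of a block spans the whole block, and by locality it spans one coordinate. Hence
every block is a single creature, and applying Σ only shrinks the sets of values coordinatewise. -/
theorem slalomLE_of_appliesComp (hl : C.Local) {p q : C.Cond}
    (h : AppliesComp p q) : SlalomLE p q := by
  obtain ⟨hw, k, hk0, hk, hq⟩ := h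
  have himage : ∀ i, p.t '' Ico (k i) (k (i + 1)) =
      (fun j => p.t (k i + j)) '' Iic (k (i + 1) - k i - 1) := by
    intro i
    have hlt := hk (Nat.lt_succ_self i)
    ext s
    constructor
    · rintro ⟨j, hj, rfl⟩
      rw [mem_Ico] at hj
      refine ⟨j - k i, by rw [mem_Iic]; omega, ?_⟩
      simp only
      congr 1
      omega
    · rintro ⟨j, hj, rfl⟩
      rw [mem_Iic] at hj
      exact ⟨k i + j, by rw [mem_Ico]; simp only [Nat.succ_eq_add_one] at hlt; omega, rfl⟩
  have hstep : ∀ i, k (i + 1) = k i + 1 := by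
    intro i
    have hlt := hk (Nat.lt_succ_self i)
    simp only [Nat.succ_eq_add_one] at hlt
    have h := hq i
    rw [himage] at h
    obtain ⟨h1, h2⟩ := C.dn_up _ (fun j => p.t (k i + j)) (fun j _ => p.mem _) (fun j _ => p.chain _) _ h
    have h3 := hl _ (q.mem i)
    rw [hl _ (p.mem _)] at h2
    rw [p.dn_t hl] at h1 h2
    omega
  have hid := eq_self_of_succ hk0 hstep
  refine ⟨hw.ge, fun n h h' => by rw [hw] at h; omega, fun n hn => ?_⟩
  rw [hw] at hn
  obtain ⟨i, rfl⟩ := Nat.exists_eq_add_of_le hn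
  have hqd := q.dn_t hl i
  rw [hw] at hqd
  rw [p.slalom_of_dn hl (p.dn_t hl i), q.slalom_of_dn hl hqd]
  have h := hq i
  rw [hid, hid] at h
  rw [image_Ico_add_one] at h
  have := pos_subset_of_mem_comp hl (p.mem i) h
  rwa [p.dn_t hl] at this

/-- For the converse two operations suffice: first decide the longer stem, then shrink every
remaining creature, which completeness allows. -/
theorem le_iff_slalomLE [∀ n, Nonempty (H n)] (hl : C.Local) (hf : C.Forgetful)
    (hc : C.Complete) {p q : C.Cond} : p ≤ q ↔ SlalomLE p q := by
  constructor
  · intro h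
    change Relation.ReflTransGen _ p q at h
    induction h with
    | refl =>
      exact ⟨le_rfl, fun n h h' => absurd h h'.not_gt, fun _ _ => subset_rfl⟩
    | tail _ h ih =>
      exact ih.trans (h.elim (slalomLE_of_decides hl hf) (slalomLE_of_appliesComp hl))
  · rintro ⟨h1, h2, h3⟩
    obtain ⟨k, hk⟩ := Nat.exists_eq_add_of_le (FinSeq.le_def.1 h1).1
    let r : C.Cond := mk' hl hf q.w (fun i => p.t (k + i)) (fun i => p.mem _)
      (fun i => by rw [p.dn_t hl, hk]; omega)
    have hpr : Decides p r := by
      -- `posSeq` always uses at least one creature, so an unchanged stem falls under the trivial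
      -- case of `Decides`.
      rcases k with _ | k
      · left
        refine ⟨(FinSeq.eq_of_le_of_len_le h1 (by omega)).symm, ?_⟩
        funext i
        change p.t (0 + i) = p.t i
        rw [zero_add]
      · right
        refine ⟨k, (mem_posSeq_iff p hl hf).2 ⟨hk, h1, h2⟩, fun i => ?_⟩
        change p.t (k + 1 + i) = _
        rfl
    have hrq : AppliesComp r q := by
      refine ⟨rfl, id, rfl, strictMono_id, fun i => ?_⟩
      rw [id, id, image_Ico_add_one]
      have hr := r.dn_t hl i
      have hq := q.dn_t hl i
      refine (hc.2 _ _ (q.mem i) _ (r.mem i) hq hr ?_).1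
      have h := h3 (q.w.len + i) (Nat.le_add_right _ _)
      have hp : (p.t (k + i)).dn = q.w.len + i := by rw [p.dn_t hl, hk]; omega
      rwa [q.slalom_of_dn hl hq, p.slalom_of_dn hl hp] at h
    exact Relation.ReflTransGen.tail (b := r) (Relation.ReflTransGen.single (Or.inl hpr))
      (Or.inr hrq)

end Cond

/-- The slalom of a condition is empty below the stem, so a prescribed sequence of sets is realized
only from the stem on; `hT` makes membership insensitive to the difference. -/
theorem isSlalom [∀ n, Nonempty (H n)] (hl : C.Local) (hf : C.Forgetful)
    (hc : C.Complete) {N : Set (ℕ → Creature H D)} {T : ℕ → Set ((n : ℕ) → Set (H n))}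
    (hN : ∀ p : C.Cond, p.t ∈ N ↔ p.slalom ∈ T p.w.len)
    (hT : ∀ m A B, (∀ n, m ≤ n → A n = B n) → A ∈ T m → B ∈ T m) :
    IsSlalom (Q := C.Forcing N) (fun p => p.1.w) (fun p => p.1.slalom) T where
  le_iff p q := Cond.le_iff_slalomLE hl hf hc
  nonempty p n hn := p.1.slalom_nonempty hl hn
  empty p n hn := p.1.slalom_of_lt hl hn
  mem p := (hN p.1).1 p.2
  exists_mk u A hA hne := by
    obtain ⟨p, rfl, hp⟩ := Cond.exists_eq hl hf hc u A hne
    exact ⟨⟨p, (hN p).2 (hT _ A _ (fun n hn => (hp n hn).symm) hA)⟩, rfl, hp⟩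

end CreatingPair

/-! ### Regular open algebras and a criterion for a name to be Cohen -/

namespace RO

variable {Q : Type*} [Preorder Q]

theorem ext_of {a b : RO Q} (h : ∀ p, p ∈ a.1 ↔ p ∈ b.1) : a = b := Subtype.ext (Set.ext h)

theorem mem_of_le {a : RO Q} {p q : Q} (hp : p ∈ a.1) (h : p ≤ q) : q ∈ a.1 :=
  (a.2 q).2 fun r hr => (a.2 p).1 hp r (h.trans hr)

end RO

namespace StdName

variable {Q : Type*} [Preorder Q] {H : ℕ → Type*} (τ : StdName Q H)

theorem mem_initVal {η : FinSeq H} {p : Q} :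
    p ∈ (τ.initVal η).1 ↔ ∀ r, p ≤ r → ∃ s, r ≤ s ∧ ∃ x, x.1.1 = η ∧ τ.q x ≤ s := by
  simp only [initVal, boolVal, RO.meets, mem_ofPred_eq, mem_singleton_iff, exists_eq_left]
  refine forall₂_congr fun r _ => exists_congr fun s => and_congr_right fun _ => ?_
  constructor
  · rintro ⟨d, ⟨x, hx, rfl⟩, h⟩
    exact ⟨x, hx, h⟩
  · rintro ⟨x, hx, h⟩
    exact ⟨_, ⟨x, hx, rfl⟩, h⟩

theorem mem_initVal_of_le {η : FinSeq H} {p : Q} {x} (hx : x.1.1 = η) (h : τ.q x ≤ p) :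
    p ∈ (τ.initVal η).1 :=
  (τ.mem_initVal).2 fun r hr => ⟨r, le_rfl, x, hx, h.trans hr⟩

theorem initVal_mono {ν η : FinSeq H} (h : ν ≤ η) {p : Q} (hp : p ∈ (τ.initVal η).1) :
    p ∈ (τ.initVal ν).1 := by
  rw [mem_initVal] at hp ⊢
  intro r hr
  obtain ⟨s, hs, x, rfl, hxs⟩ := hp r hr
  obtain ⟨y, hy, hyx⟩ := τ.mono x ν h
  exact ⟨s, hs, y, hy, hyx.trans hxs⟩

theorem eq_of_mem_initVal {ν η : FinSeq H} (hl : ν.len = η.len) {p : Q}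
    (hν : p ∈ (τ.initVal ν).1) (hη : p ∈ (τ.initVal η).1) : ν = η := by
  obtain ⟨s, hs, x, rfl, hxs⟩ := τ.mem_initVal.1 hν p le_rfl
  obtain ⟨r, hr, y, rfl, hyr⟩ := τ.mem_initVal.1 hη s hs
  by_contra hne
  exact τ.antichain x y hl (fun h => hne (by rw [h])) ⟨r, hxs.trans hr, hyr⟩

theorem le_of_mem_initVal {ν η : FinSeq H} (hl : ν.len ≤ η.len) {p : Q}
    (hν : p ∈ (τ.initVal ν).1) (hη : p ∈ (τ.initVal η).1) : ν ≤ η := by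
  have h := τ.initVal_mono (η.take_le ν.len) hη
  rw [τ.eq_of_mem_initVal (FinSeq.take_len hl).symm hν h]
  exact η.take_le _

/-- The map from `RO(2^{<ω})` which sends the Boolean value of `η ◁ W` to that of `η ◁ τ`. -/
def embed (τ : StdName Q H) (a : RO (FinSeq H)) : RO Q := RO.sup (τ.initVal '' a.1)

theorem mem_embed {a : RO (FinSeq H)} {p : Q} :
    p ∈ (τ.embed a).1 ↔ ∀ r, p ≤ r → ∃ s, r ≤ s ∧ ∃ η ∈ a.1, s ∈ (τ.initVal η).1 := by
  simp [embed, RO.sup]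

theorem mem_embed_of_mem {a : RO (FinSeq H)} {p : Q} {η : FinSeq H} (hη : η ∈ a.1)
    (hp : p ∈ (τ.initVal η).1) : p ∈ (τ.embed a).1 :=
  τ.mem_embed.2 fun r hr => ⟨r, le_rfl, η, hη, RO.mem_of_le hp hr⟩

variable {τ}

/-- If every finite sequence is possible for τ, then inclusion can be read off inside 2^{<ω}: given
an extension η' of a member of `a`, a condition forcing η' ◁ τ has an extension forcing ζ ◁ τ for
some ζ ∈ b, and ζ and η' are comparable. -/
theorem embed_le_iff (hne : ∀ η, (τ.initVal η).1.Nonempty) {a b : RO (FinSeq H)} :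
    τ.embed a ≤ τ.embed b ↔ a ≤ b := by
  constructor
  · intro h η hη
    rw [b.2]
    intro η' hη'
    obtain ⟨p, hp⟩ := hne η'
    have hpa := τ.mem_embed_of_mem (RO.mem_of_le hη hη') hp
    obtain ⟨s, hs, ζ, hζ, hsζ⟩ := τ.mem_embed.1 (h hpa) p le_rfl
    have hs' := RO.mem_of_le hp hs
    rcases le_total ζ.len η'.len with hl | hl
    · exact ⟨η', le_rfl, RO.mem_of_le hζ (τ.le_of_mem_initVal hl hsζ hs')⟩
    · exact ⟨ζ, τ.le_of_mem_initVal hl hs' hsζ, hζ⟩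
  · intro h p hp
    refine τ.mem_embed.2 fun r hr => ?_
    obtain ⟨s, hs, η, hη, hsη⟩ := τ.mem_embed.1 hp r hr
    exact ⟨s, hs, η, h hη, hsη⟩

/-- For every condition `p` there is a finite sequence all of whose extensions are compatible
with `p`. -/
def HasCohenReductions (τ : StdName Q H) : Prop :=
  ∀ p : Q, ∃ η : FinSeq H, ∀ η', η ≤ η' → ∃ q, p ≤ q ∧ q ∈ (τ.initVal η').1

/-- A reduction of `p` is comparable with every sequence that `p` already forces into τ, so it can
be taken above that sequence. -/
theorem HasCohenReductions.exists_ge (h : τ.HasCohenReductions) {p : Q} {ζ : FinSeq H}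
    (hp : p ∈ (τ.initVal ζ).1) :
    ∃ η, ζ ≤ η ∧ ∀ η', η ≤ η' → ∃ q, p ≤ q ∧ q ∈ (τ.initVal η').1 := by
  obtain ⟨η, hη⟩ := h p
  obtain ⟨q, hq, hqη⟩ := hη η le_rfl
  rcases le_total ζ.len η.len with hl | hl
  · exact ⟨η, τ.le_of_mem_initVal hl (RO.mem_of_le hp hq) hqη, hη⟩
  · exact ⟨ζ, le_rfl, fun η' h' =>
      hη η' ((τ.le_of_mem_initVal hl hqη (RO.mem_of_le hp hq)).trans h')⟩

theorem embed_meets (h : τ.HasCohenReductions) (η : FinSeq H) :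
    τ.embed (RO.meets {η}) = τ.initVal η := by
  apply RO.ext_of
  intro p
  constructor
  · intro hp
    rw [(τ.initVal η).2]
    intro r hr
    obtain ⟨s, hs, ζ, hζ, hsζ⟩ := τ.mem_embed.1 hp r hr
    obtain ⟨ξ, hξ, hξ'⟩ := h.exists_ge hsζ
    obtain ⟨ξ', h1, d, rfl, h2⟩ := hζ ξ hξ
    obtain ⟨q, hq, hq'⟩ := hξ' ξ' h1
    exact ⟨q, hs.trans hq, τ.initVal_mono h2 hq'⟩
  · intro hp
    exact τ.mem_embed_of_mem (fun r hr => ⟨r, le_rfl, η, rfl, hr⟩) hp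

/-- For the inclusion from right to left: no extension of a reduction η of `r` lies in `a`, since
some condition above `r` would then force the value of `a`. Hence η itself lies in the complement of
`a`. -/
theorem embed_compl (h : τ.HasCohenReductions) (a : RO (FinSeq H)) :
    τ.embed (RO.compl a) = RO.compl (τ.embed a) := by
  apply RO.ext_of
  intro p
  constructor
  · intro hp r hr hra
    obtain ⟨s, hs, η, hη, hsη⟩ := τ.mem_embed.1 hp r hr
    obtain ⟨s', hs', ζ, hζ, hsζ⟩ := τ.mem_embed.1 hra s hs
    have hη' := RO.mem_of_le hsη hs'
    rcases le_total ζ.len η.len with hl | hl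
    · exact hη η le_rfl (RO.mem_of_le hζ (τ.le_of_mem_initVal hl hsζ hη'))
    · exact hη ζ (τ.le_of_mem_initVal hl hη' hsζ) hζ
  · intro hp
    refine τ.mem_embed.2 fun r hr => ?_
    obtain ⟨η, hη⟩ := h r
    obtain ⟨q, hq, hqη⟩ := hη η le_rfl
    refine ⟨q, hq, η, fun η' hη' ha => ?_, hqη⟩
    obtain ⟨q', hq', hqη'⟩ := hη η' hη'
    exact hp q' (hr.trans hq') (τ.mem_embed_of_mem ha hqη')

theorem embed_sup (h : τ.HasCohenReductions) (T : Set (RO (FinSeq H))) :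
    τ.embed (RO.sup T) = RO.sup (τ.embed '' T) := by
  apply RO.ext_of
  intro p
  constructor
  · intro hp r hr
    obtain ⟨s, hs, η, hη, hsη⟩ := τ.mem_embed.1 hp r hr
    obtain ⟨ζ, hζ, hζ'⟩ := h.exists_ge hsη
    obtain ⟨ξ, hξ, a, ha, hξa⟩ := hη ζ hζ
    obtain ⟨q, hq, hqξ⟩ := hζ' ξ hξ
    exact ⟨q, hs.trans hq, _, ⟨a, ha, rfl⟩, τ.mem_embed_of_mem hξa hqξ⟩
  · intro hp
    refine τ.mem_embed.2 fun r hr => ?_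
    obtain ⟨s, hs, _, ⟨a, ha, rfl⟩, hsa⟩ := hp r hr
    obtain ⟨q, hq, η, hη, hqη⟩ := τ.mem_embed.1 hsa s le_rfl
    exact ⟨q, hs.trans hq, η,
      fun r hr => ⟨r, le_rfl, a, ha, RO.mem_of_le hη hr⟩, hqη⟩

/-- The range consists of suprema of generators, hence lies in every complete subalgebra containing
them; by the preceding lemmas it is itself such a subalgebra. -/
theorem range_embed (h : τ.HasCohenReductions) :
    Set.range τ.embed = RO.generated (Set.range τ.initVal) := by
  apply subset_antisymm
  · rintro _ ⟨a, rfl⟩ S ⟨hG, hS, -⟩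
    refine hS _ ?_
    rintro _ ⟨η, -, rfl⟩
    exact hG ⟨η, rfl⟩
  · refine sInter_subset_of_mem ⟨?_, fun T hT => ?_, ?_⟩
    · rintro _ ⟨η, rfl⟩
      exact ⟨_, embed_meets h η⟩
    · refine ⟨RO.sup (τ.embed ⁻¹' T), ?_⟩
      rw [embed_sup h, image_preimage_eq_of_subset hT]
    · rintro _ ⟨a, rfl⟩
      exact ⟨_, embed_compl h a⟩

end StdName

theorem sameGeneric_cohenReal {Q : Type*} [Preorder Q] {τ : StdName Q (fun _ : ℕ => Bool)}
    (hne : ∀ η, (τ.initVal η).1.Nonempty) (h : τ.HasCohenReductions) :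
    SameGeneric cohenReal τ := by
  let F : RO BinSeq ↪o {a : RO Q // a ∈ RO.generated (Set.range τ.initVal)} :=
    OrderEmbedding.ofMapLEIff
      (fun a => ⟨τ.embed a, StdName.range_embed h ▸ mem_range_self a⟩)
      fun a b => StdName.embed_le_iff hne
  refine ⟨RelIso.ofSurjective F ?_, fun η => StdName.embed_meets h η⟩
  rintro ⟨a, ha⟩
  obtain ⟨b, rfl⟩ : a ∈ Set.range τ.embed := (StdName.range_embed h).symm ▸ ha
  exact ⟨b, rfl⟩

/-- Lets the members of a countable family serve as the indices k < N_η of a standard name. -/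
theorem nonempty_equiv_lt_card (α : Type*) [Countable α] :
    Nonempty ({k : ℕ // (k : ℕ∞) < ENat.card α} ≃ α) := by
  cases finite_or_infinite α
  · have := Fintype.ofFinite α
    refine ⟨(Equiv.subtypeEquivRight fun k => ?_).trans
      (Fin.equivSubtype.symm.trans (Fintype.equivFin α).symm)⟩
    rw [ENat.card_eq_coe_fintype_card, Nat.cast_lt]
  · obtain ⟨e⟩ := nonempty_denumerable α
    refine ⟨(Equiv.subtypeUnivEquiv fun k => ?_).trans (Denumerable.eqv α).symm⟩
    rw [ENat.card_eq_top_of_infinite]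
    exact ENat.natCast_lt_top k

/-! ### Slalom forcing: compatibility, ccc and the names -/

section Slalom

variable {H : ℕ → Type*}

/-- The norm conditions on slaloms which depend only on almost all terms. -/
structure NormBase (N : Set ((n : ℕ) → Set (H n))) : Prop where
  mono : ∀ A ∈ N, ∀ B : (n : ℕ) → Set (H n), (∀ᶠ n in atTop, A n ⊆ B n) → B ∈ N
  inter : ∀ A ∈ N, ∀ B ∈ N, (fun n => A n ∩ B n) ∈ N
  inter_nonempty : ∀ A ∈ N, ∀ B ∈ N, ∀ᶠ n in atTop, (A n ∩ B n).Nonempty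
  compl_singleton : ∀ d : (n : ℕ) → H n, (fun n => {d n}ᶜ) ∈ N
  linked : ∃ E : ℕ → ℕ → Set ((n : ℕ) → Set (H n)),
    (∀ A ∈ N, ∃ j m₀, ∀ m, m₀ ≤ m → A ∈ E j m) ∧
    ∀ j m, ∀ A ∈ E j m, ∀ B ∈ E j m, ∀ n, m ≤ n → (A n ∩ B n).Nonempty

/-- The slalom which avoids the points `a ρ (pos ρ)` for `ρ ◁ x`. -/
def avoidBranch (pos : BinSeq → ℕ) (a : BinSeq → (n : ℕ) → H n) (x : ℕ → Bool) (n : ℕ) :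
    Set (H n) :=
  {v | ∀ ρ, InitSeg ρ x → pos ρ = n → v ≠ a ρ n}

/-- The additional norm conditions which are given by norming systems. -/
structure BranchNorm (pos : BinSeq → ℕ) (a : BinSeq → (n : ℕ) → H n)
    (M : ℕ → Set ((n : ℕ) → Set (H n))) : Prop where
  injective : Function.Injective pos
  len_le : ∀ ρ, ρ.len ≤ pos ρ
  congr : ∀ m A B, (∀ n, m ≤ n → A n = B n) → A ∈ M m → B ∈ M m
  mono : ∀ m m', m ≤ m' → M m ⊆ M m'
  inter : ∀ m, ∀ A ∈ M m, ∀ B ∈ M m, (fun n => A n ∩ B n) ∈ M m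
  univ : ∀ m, (fun _ => Set.univ) ∈ M m
  avoidBranch : ∀ m x, avoidBranch pos a x ∈ M m
  split : ∀ m, ∀ A ∈ M m, ∃ l, ∀ σ : BinSeq, l ≤ σ.len →
    ∃ b, m ≤ pos (σ.snoc b) → a (σ.snoc b) (pos (σ.snoc b)) ∈ A (pos (σ.snoc b))

/-- The conjunction of two norm conditions. -/
def normInter (N : Set ((n : ℕ) → Set (H n))) (M : ℕ → Set ((n : ℕ) → Set (H n))) (m : ℕ) :
    Set ((n : ℕ) → Set (H n)) := N ∩ M m

theorem NormBase.univ_mem [∀ n, Nonempty (H n)] {N : Set ((n : ℕ) → Set (H n))} (hN : NormBase N) :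
    (fun _ => Set.univ) ∈ N :=
  hN.mono _ (hN.compl_singleton fun _ => Classical.arbitrary _) _
    (Eventually.of_forall fun _ => subset_univ _)

variable {Q : Type*} [Preorder Q] {w : Q → FinSeq H} {S : Q → (n : ℕ) → Set (H n)}
  {N : Set ((n : ℕ) → Set (H n))} {M : ℕ → Set ((n : ℕ) → Set (H n))}
  {pos : BinSeq → ℕ} {a : BinSeq → (n : ℕ) → H n}

namespace IsSlalom

section Basic

variable {T : ℕ → Set ((n : ℕ) → Set (H n))}

theorem exists_branch [∀ n, Nonempty (H n)] (hQ : IsSlalom w S T) (p : Q) :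
    ∃ x : (n : ℕ) → H n, restr x (w p).len = w p ∧ ∀ n, (w p).len ≤ n → x n ∈ S p n := by
  have : ∀ n, ∃ v : H n, (∀ h : n < (w p).len, (w p).val ⟨n, h⟩ = v) ∧
      ((w p).len ≤ n → v ∈ S p n) := by
    intro n
    rcases lt_or_ge n (w p).len with h | h
    · exact ⟨(w p).val ⟨n, h⟩, fun _ => rfl, fun h' => absurd h h'.not_gt⟩
    · obtain ⟨v, hv⟩ := hQ.nonempty p n h
      exact ⟨v, fun h' => absurd h' h.not_gt, fun _ => hv⟩
  choose x hx hx' using this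
  exact ⟨x, FinSeq.ext_of_forall rfl fun i hi _ => hx i hi, hx'⟩

end Basic

variable (hQ : IsSlalom w S (normInter N M)) (hN : NormBase N) (hM : BranchNorm pos a M)

include hQ hM in
theorem exists_le_of_branch {p : Q} {x : (n : ℕ) → H n} (hx : w p ≤ restr x (w p).len)
    (hx' : ∀ n, (w p).len ≤ n → x n ∈ S p n) {l : ℕ} (hl : (w p).len ≤ l) :
    ∃ q, p ≤ q ∧ w q = restr x l ∧ ∀ n, l ≤ n → S q n = S p n := by
  obtain ⟨q, hq, hqS⟩ := hQ.exists_mk (restr x l) (S p)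
    ⟨(hQ.mem p).1, hM.mono _ _ hl (hQ.mem p).2⟩ fun n hn => hQ.nonempty p n (hl.trans hn)
  refine ⟨q, (hQ.le_iff p q).2 ?_, hq, hqS⟩
  rw [hq]
  exact ⟨hx.trans (FinSeq.restr_le_restr x hl), fun n _ hn => hx' n hn,
    fun n hn => (hqS n hn).subset⟩

include hQ hM in
theorem exists_len_eq [∀ n, Nonempty (H n)] (p : Q) {l : ℕ} (hl : (w p).len ≤ l) :
    ∃ q, p ≤ q ∧ (w q).len = l ∧ ∀ n, l ≤ n → S q n = S p n := by
  obtain ⟨x, hx, hx'⟩ := hQ.exists_branch p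
  obtain ⟨q, hq, hqw, hqS⟩ := hQ.exists_le_of_branch hM hx.ge hx' hl
  exact ⟨q, hq, by rw [hqw]; rfl, hqS⟩

include hQ hN hM in
-- The longer stem with the intersected slaloms is a common extension: both norm conditions are
-- closed under intersection, so only nonemptiness of each coordinate has to be demanded.
theorem compat_iff [∀ n, Nonempty (H n)] {p q : Q} (hpq : (w p).len ≤ (w q).len) :
    Compat p q ↔ w p ≤ w q ∧
      (∀ n (h : n < (w q).len), (w p).len ≤ n → (w q).val ⟨n, h⟩ ∈ S p n) ∧
      ∀ n, (w q).len ≤ n → (S p n ∩ S q n).Nonempty := by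
  constructor
  · rintro ⟨r, hpr, hqr⟩
    rw [hQ.le_iff] at hpr hqr
    refine ⟨FinSeq.le_total_of_le hpr.1 hqr.1 hpq, fun n hn hpn => ?_, fun n hn => ?_⟩
    · have hr := hn.trans_le (FinSeq.le_def.1 hqr.1).1
      rw [← (FinSeq.le_def.1 hqr.1).2 n hn hr]
      exact hpr.2.1 n hr hpn
    · rcases lt_or_ge n (w r).len with h | h
      · exact ⟨_, hpr.2.1 n h (hpq.trans hn), hqr.2.1 n h hn⟩
      · exact (hQ.nonempty r n h).mono (subset_inter (hpr.2.2 n h) (hqr.2.2 n h))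
  · rintro ⟨h1, h2, h3⟩
    obtain ⟨r, hr, hrS⟩ := hQ.exists_mk (w q) (fun n => S p n ∩ S q n)
      ⟨hN.inter _ (hQ.mem p).1 _ (hQ.mem q).1,
        hM.inter _ _ (hM.mono _ _ hpq (hQ.mem p).2) _ (hQ.mem q).2⟩ h3
    refine ⟨r, (hQ.le_iff p r).2 ?_, (hQ.le_iff q r).2 ?_⟩
    · rw [hr]
      exact ⟨h1, h2, fun n hn => (hrS n hn).subset.trans inter_subset_left⟩
    · rw [hr]
      exact ⟨le_rfl, fun n hn hn' => absurd hn hn'.not_gt,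
        fun n hn => (hrS n hn).subset.trans inter_subset_right⟩

include hQ hN hM in
theorem compat_of_eq [∀ n, Nonempty (H n)] {p q : Q} (h : w p = w q)
    (hS : ∀ n, (w q).len ≤ n → (S p n ∩ S q n).Nonempty) : Compat p q :=
  (hQ.compat_iff hN hM (by rw [h])).2
    ⟨h.le, fun n hn hn' => absurd (h ▸ hn') hn.not_ge, hS⟩

include hQ hN hM in
-- Each condition is extended until its stem is so long that its slalom lies in a linked class from
-- there on. There are countably many pairs of a class and a stem, and conditions with the same pair
-- are compatible.
theorem ccc [∀ n, Countable (H n)] [∀ n, Nonempty (H n)] : CCC Q := by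
  intro A hA
  obtain ⟨E, hE, hE'⟩ := hN.linked
  have : ∀ p : Q, ∃ q j, p ≤ q ∧ S p ∈ E j (w q).len ∧ ∀ n, (w q).len ≤ n → S q n = S p n := by
    intro p
    obtain ⟨j, m₀, hm₀⟩ := hE _ (hQ.mem p).1
    obtain ⟨q, hpq, hq, hqS⟩ := hQ.exists_len_eq hM p (le_max_left (w p).len m₀)
    exact ⟨q, j, hpq, hm₀ _ (hq ▸ le_max_right _ _), hq ▸ hqS⟩
  choose F J hF hJ hS using this
  refine MapsTo.countable_of_injOn (f := fun p => (J p, w (F p))) (mapsTo_univ _ _) ?_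
    countable_univ
  intro p hp q hq hpq
  obtain ⟨hj, hw⟩ := Prod.mk.inj hpq
  by_contra hne
  have h1 := hJ p
  rw [hj, hw] at h1
  obtain ⟨r, h3, h4⟩ := hQ.compat_of_eq hN hM hw fun n hn => by
    rw [hS p n (hw ▸ hn), hS q n hn]
    exact hE' _ _ _ h1 _ (hJ q) n hn
  exact hA hp hq hne ⟨r, (hF p).trans h3, (hF q).trans h4⟩

/-! ### The Cohen names -/

section Names

/-- `σ` is hit by `u`: for some `b` the value of `u` at `pos (σ⌢b)` is `a (σ⌢b) (pos (σ⌢b))`. -/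
def Hit (pos : BinSeq → ℕ) (a : BinSeq → (n : ℕ) → H n) (u : FinSeq H) (σ : BinSeq) : Prop :=
  ∃ b, ∃ h : pos (σ.snoc b) < u.len, u.val ⟨_, h⟩ = a (σ.snoc b) (pos (σ.snoc b))

open Classical in
/-- The first `n` bits of the Cohen real given by `u`, which tell whether the `i`-th member of
`2^{<ω}` is hit by `u`; all bits are flipped if `c = true`. -/
noncomputable def bits (pos : BinSeq → ℕ) (a : BinSeq → (n : ℕ) → H n) (e : ℕ ≃ BinSeq) (c : Bool)
    (u : FinSeq H) (n : ℕ) : BinSeq :=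
  ⟨n, fun i => xor (decide (Hit pos a u (e i))) c⟩

open Classical in
theorem bits_val {e : ℕ ≃ BinSeq} {c : Bool} {u : FinSeq H} {n i : ℕ}
    (h : i < (bits pos a e c u n).len) :
    (bits pos a e c u n).val ⟨i, h⟩ = xor (decide (Hit pos a u (e i))) c := rfl

/-- A length which suffices to determine the first `n` bits. -/
def bound (pos : BinSeq → ℕ) (e : ℕ ≃ BinSeq) (n : ℕ) : ℕ :=
  ∑ i ∈ Finset.range n, (pos ((e i).snoc false) + pos ((e i).snoc true) + 1)

variable {e : ℕ ≃ BinSeq}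

theorem pos_lt_bound {i n : ℕ} (h : i < n) (b : Bool) : pos ((e i).snoc b) < bound pos e n := by
  have : pos ((e i).snoc false) + pos ((e i).snoc true) + 1 ≤ bound pos e n := Finset.single_le_sum
    (f := fun i => pos ((e i).snoc false) + pos ((e i).snoc true) + 1) (s := Finset.range n)
    (fun _ _ => Nat.zero_le _) (Finset.mem_range.2 h)
  refine lt_of_lt_of_le ?_ this
  cases b <;> omega

theorem bound_mono {m n : ℕ} (h : m ≤ n) : bound pos e m ≤ bound pos e n :=
  Finset.sum_le_sum_of_subset (Finset.range_mono h)

theorem hit_congr {u v : FinSeq H} {σ : BinSeq}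
    (h : ∀ b, ∃ (h : pos (σ.snoc b) < u.len) (h' : pos (σ.snoc b) < v.len),
      v.val ⟨_, h'⟩ = u.val ⟨_, h⟩) : Hit pos a u σ ↔ Hit pos a v σ := by
  refine exists_congr fun b => ?_
  obtain ⟨h1, h2, h3⟩ := h b
  simp only [h1, h2, exists_true_left, h3]

theorem bits_congr {c : Bool} {u v : FinSeq H} {n : ℕ} (h : u ≤ v) (hn : bound pos e n ≤ u.len) :
    bits pos a e c u n = bits pos a e c v n := by
  unfold bits
  congr 1
  funext i
  have : Hit pos a u (e i) ↔ Hit pos a v (e i) := hit_congr fun b => by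
    have h1 := (pos_lt_bound (pos := pos) (e := e) i.2 b).trans_le hn
    have h2 := h1.trans_le (FinSeq.le_def.1 h).1
    exact ⟨h1, h2, (FinSeq.le_def.1 h).2 _ h1 h2⟩
  exact congrArg (xor · c) (decide_eq_decide.2 this)

theorem bits_take {c : Bool} {u : FinSeq H} {m n : ℕ} (h : m ≤ n) :
    (bits pos a e c u n).take m = bits pos a e c u m :=
  FinSeq.ext_of_forall (min_eq_left h) fun _ _ _ => rfl

include hQ hN hM in
-- Conditions with full slaloms serve as the members of the antichains in the names: lying above one
-- of them only constrains the stem.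
theorem exists_full [∀ n, Nonempty (H n)] (u : FinSeq H) :
    ∃ p, w p = u ∧ ∀ q, p ≤ q ↔ u ≤ w q := by
  obtain ⟨p, hp, hpS⟩ := hQ.exists_mk u (fun _ => Set.univ) ⟨hN.univ_mem, hM.univ _⟩
    fun _ _ => univ_nonempty
  refine ⟨p, hp, fun q => ?_⟩
  rw [hQ.le_iff, hp]
  refine ⟨And.left, fun h => ⟨h, fun n _ hn => ?_, fun n hn => ?_⟩⟩
  · rw [hpS n hn]
    trivial
  · rw [hpS n ((FinSeq.le_def.1 h).1.trans hn)]
    exact subset_univ _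

include hQ hN hM in
theorem exists_name [∀ n, Countable (H n)] [∀ n, Nonempty (H n)] (e : ℕ ≃ BinSeq) (c : Bool) :
    ∃ τ : StdName Q (fun _ : ℕ => Bool), ∀ p n, bound pos e n ≤ (w p).len →
      ∃ x, x.1.1 = bits pos a e c (w p) n ∧ τ.q x ≤ p := by
  choose full hw hfull using hQ.exists_full hN hM
  -- The antichain at level n consists of all stems of length `bound pos e n`, sorted by the first n
  -- bits that they determine.
  let I : BinSeq → Type _ := fun η =>
    {u : FinSeq H // u.len = bound pos e η.len ∧ bits pos a e c u η.len = η}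
  have F := fun η => (nonempty_equiv_lt_card (I η)).some
  have hF : ∀ (η : BinSeq) (u : FinSeq H) (h : u.len = bound pos e η.len ∧
      bits pos a e c u η.len = η), ∃ k, ((F η k).1 = u) := fun η u h =>
    ⟨(F η).symm ⟨u, h⟩, by rw [Equiv.apply_symm_apply]⟩
  let q : {x : BinSeq × ℕ // (x.2 : ℕ∞) < ENat.card (I x.1)} → Q :=
    fun x => full (F x.1.1 ⟨x.1.2, x.2⟩).1
  have key : ∀ p n, bound pos e n ≤ (w p).len → ∃ x, x.1.1 = bits pos a e c (w p) n ∧ q x ≤ p := by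
    intro p n hn
    have hl := FinSeq.take_len hn
    obtain ⟨k, hk⟩ := hF (bits pos a e c (w p) n) ((w p).take (bound pos e n))
      ⟨hl, bits_congr (FinSeq.take_le _ _) hl.ge⟩
    refine ⟨⟨(_, k.1), k.2⟩, rfl, ?_⟩
    change full (F _ k).1 ≤ p
    rw [hk, hfull]
    exact FinSeq.take_le _ _
  refine ⟨⟨fun η => ENat.card (I η), q, ?_, ?_, ?_⟩, key⟩
  · rintro ⟨⟨η, k⟩, hk⟩ ⟨⟨η', k'⟩, hk'⟩ hl hne ⟨r, h1, h2⟩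
    refine hne ?_
    have g1 := (F η ⟨k, hk⟩).2
    have g2 := (F η' ⟨k', hk'⟩).2
    change full (F η ⟨k, hk⟩).1 ≤ r at h1
    change full (F η' ⟨k', hk'⟩).1 ≤ r at h2
    rw [hfull] at h1 h2
    change η.len = η'.len at hl
    have hu : (F η ⟨k, hk⟩).1 = (F η' ⟨k', hk'⟩).1 :=
      FinSeq.eq_of_le_of_len_le (FinSeq.le_total_of_le h1 h2 (by rw [g1.1, g2.1, hl]))
        (by rw [g1.1, g2.1, hl])
    obtain rfl : η = η' := by rw [← g1.2, ← g2.2, hu, hl]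
    have := (F η).injective (Subtype.ext hu)
    simpa using this
  · intro n p
    obtain ⟨r, hr, hrl, -⟩ := hQ.exists_len_eq hM p (le_max_left (w p).len (bound pos e n))
    obtain ⟨x, hx, hxr⟩ := key r n (hrl ▸ le_max_right _ _)
    exact ⟨x, by rw [hx]; rfl, r, hr, hxr⟩
  · rintro ⟨⟨η, k⟩, hk⟩ ν hν
    have g := (F η ⟨k, hk⟩).2
    have hl := (FinSeq.le_def.1 hν).1
    have hb : bound pos e ν.len ≤ (w (full (F η ⟨k, hk⟩).1)).len := by
      rw [hw, g.1]
      exact bound_mono hl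
    obtain ⟨y, hy, hyq⟩ := key _ _ hb
    refine ⟨y, ?_, hyq⟩
    rw [hy, hw, ← bits_take hl, g.2, FinSeq.take_of_le hν]

open Classical in
include hQ hM in
/-- The bits from `i₀` on can be chosen freely. -/
theorem exists_bits_eq [∀ n, Nonempty (H n)] (c : Bool) (p : Q) (i₀ : ℕ)
    (h : ∀ i, i₀ ≤ i →
      (∃ b, a ((e i).snoc b) (pos ((e i).snoc b)) ∈ S p (pos ((e i).snoc b))) ∧
      ∀ b, (w p).len ≤ pos ((e i).snoc b) ∧
        (S p (pos ((e i).snoc b)) \ {a ((e i).snoc b) (pos ((e i).snoc b))}).Nonempty) :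
    ∃ η : BinSeq, η.len = i₀ ∧ ∀ η', η ≤ η' →
      ∃ q, p ≤ q ∧ bound pos e η'.len ≤ (w q).len ∧ bits pos a e c (w q) η'.len = η' := by
  obtain ⟨x, hx, hx'⟩ := hQ.exists_branch p
  refine ⟨bits pos a e c (restr x (bound pos e i₀)) i₀, rfl, fun η' hη => ?_⟩
  have hl : i₀ ≤ η'.len := (FinSeq.le_def.1 hη).1
  choose! b₀ hb₀ using fun i hi => (h i hi).1
  let target : ℕ → Prop := fun i => ∃ hi : i < η'.len, xor (η'.val ⟨i, hi⟩) c = true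
  -- The values of the new branch. At positions attached to an index i ≥ i₀, the marked point is
  -- taken at the one permitted b = `b₀ i` if the i-th node should be hit, and avoided for both b if
  -- not; elsewhere `x` is followed. Injectivity of `pos` prevents conflicting demands.
  have key : ∀ n, ∃ v : H n, ((w p).len ≤ n → v ∈ S p n) ∧
      (∀ i, i₀ ≤ i → ∀ b, pos ((e i).snoc b) = n → (target i → b = b₀ i →
        v = a ((e i).snoc b) n) ∧ (¬ target i → v ≠ a ((e i).snoc b) n)) ∧
      ((∀ i, i₀ ≤ i → ∀ b, pos ((e i).snoc b) ≠ n) → v = x n) := by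
    intro n
    by_cases hn : ∃ i, i₀ ≤ i ∧ ∃ b, pos ((e i).snoc b) = n
    · obtain ⟨i, hi, b, rfl⟩ := hn
      have huniq : ∀ i' b', pos ((e i').snoc b') = pos ((e i).snoc b) → i' = i ∧ b' = b := by
        intro i' b' hh
        obtain ⟨h1, h2⟩ := FinSeq.snoc_injective (hM.injective hh)
        exact ⟨e.injective h1, h2⟩
      have hv : ∃ v, v ∈ S p (pos ((e i).snoc b)) ∧
          (target i → b = b₀ i → v = a ((e i).snoc b) (pos ((e i).snoc b))) ∧
          (¬ target i → v ≠ a ((e i).snoc b) (pos ((e i).snoc b))) := by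
        by_cases ht : target i
        · by_cases hb : b = b₀ i
          · subst hb
            exact ⟨_, hb₀ i hi, fun _ _ => rfl, fun h => absurd ht h⟩
          · exact ⟨_, hx' _ ((h i hi).2 b).1, fun _ h => absurd h hb, fun h => absurd ht h⟩
        · obtain ⟨v, hv, hv'⟩ := ((h i hi).2 b).2
          exact ⟨v, hv, fun h => absurd h ht, fun _ => hv'⟩
      obtain ⟨v, hv1, hv2, hv3⟩ := hv
      refine ⟨v, fun _ => hv1, fun i' _ b' hh => ?_, fun hh => absurd rfl (hh i hi b)⟩
      obtain ⟨rfl, rfl⟩ := huniq i' b' hh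
      exact ⟨hv2, hv3⟩
    · push Not at hn
      exact ⟨x n, hx' n, fun i hi b hb => absurd hb (hn i hi b), fun _ => rfl⟩
  choose y hy1 hy2 hy3 using key
  have hyx : w p ≤ restr y (w p).len := by
    refine FinSeq.le_def.2 ⟨le_rfl, fun i hi hi' => ?_⟩
    refine Eq.trans ?_ ((FinSeq.le_def.1 hx.le).2 i hi' hi).symm
    exact hy3 i fun j hj b hb => absurd ((h j hj).2 b).1 (by rw [hb]; exact hi'.not_ge)
  obtain ⟨q, hpq, hq, -⟩ := hQ.exists_le_of_branch hM hyx hy1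
    (le_max_left (w p).len (bound pos e η'.len))
  refine ⟨q, hpq, by rw [hq]; exact le_max_right _ _, ?_⟩
  rw [hq]
  refine FinSeq.ext_of_forall rfl fun i hi hi' => ?_
  have hpos : ∀ b, pos ((e i).snoc b) < max (w p).len (bound pos e η'.len) := fun b =>
    (pos_lt_bound hi b).trans_le (le_max_right _ _)
  rw [bits_val]
  rcases lt_or_ge i i₀ with hlt | hge
  · refine ((FinSeq.le_def.1 hη).2 i hlt hi').trans ?_
    refine Eq.trans (bits_val (h := hlt)) ?_
    -- Bits below i₀ are inherited from `x`, as their positions differ from those of the later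
    -- nodes.
    have : Hit pos a (restr x (bound pos e i₀)) (e i) ↔
        Hit pos a (restr y (max (w p).len (bound pos e η'.len))) (e i) :=
      hit_congr fun b => ⟨pos_lt_bound hlt b, hpos b, hy3 _ fun j hj b' hb' => by
        obtain ⟨h1, -⟩ := FinSeq.snoc_injective (hM.injective hb')
        exact absurd (e.injective h1) (by omega)⟩
    rw [decide_eq_decide.2 this]
  · have : Hit pos a (restr y (max (w p).len (bound pos e η'.len))) (e i) ↔ target i := by
      constructor
      · rintro ⟨b, hb, hyb⟩
        by_contra ht
        exact (hy2 _ i hge b rfl).2 ht hyb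
      · intro ht
        exact ⟨b₀ i, hpos _, (hy2 _ i hge _ rfl).1 ht rfl⟩
    have h2 : target i ↔ xor (η'.val ⟨i, hi'⟩) c = true :=
      ⟨fun ⟨_, h⟩ => h, fun h => ⟨hi', h⟩⟩
    have h3 := Bool.eq_iff_iff.2 ((decide_eq_true_iff
      (p := Hit pos a (restr y (max (w p).len (bound pos e η'.len))) (e i))).trans (this.trans h2))
    rw [h3, Bool.xor_assoc, Bool.xor_self, Bool.xor_false]

end Names

end IsSlalom

end Slalom

/-! ### Cohen genericity of the names and sourness -/

namespace IsSlalom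

variable {H : ℕ → Type*} {Q : Type*} [Preorder Q] {w : Q → FinSeq H}
  {S : Q → (n : ℕ) → Set (H n)}
  {N : Set ((n : ℕ) → Set (H n))} {M : ℕ → Set ((n : ℕ) → Set (H n))}
  {pos : BinSeq → ℕ} {a : BinSeq → (n : ℕ) → H n}
  (hQ : IsSlalom w S (normInter N M)) (hN : NormBase N) (hM : BranchNorm pos a M)
  {e : ℕ ≃ BinSeq}

theorem exists_forall_le_len (e : ℕ ≃ BinSeq) (l : ℕ) : ∃ i₀, ∀ i, i₀ ≤ i → l ≤ (e i).len := by
  obtain ⟨b, hb⟩ := ((FinSeq.finite_len_lt l).preimage e.injective.injOn).bddAbove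
  refine ⟨b + 1, fun i hi => ?_⟩
  by_contra! h
  have := hb h
  omega

/-- As `pos` is injective, one point per coordinate covers all the marked points, so avoiding any of
them is a matter of omitting a single value at each n. -/
theorem exists_point [∀ n, Nonempty (H n)] (h : Function.Injective pos) :
    ∃ d : (n : ℕ) → H n, ∀ ρ, d (pos ρ) = a ρ (pos ρ) := by
  have : ∀ n, ∃ v : H n, ∀ ρ, pos ρ = n → v = a ρ n := by
    intro n
    by_cases hn : ∃ ρ, pos ρ = n
    · obtain ⟨ρ, rfl⟩ := hn
      exact ⟨a ρ (pos ρ), fun ρ' h' => by rw [h h']⟩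
    · exact ⟨Classical.arbitrary _, fun ρ h' => absurd ⟨ρ, h'⟩ hn⟩
  choose d hd using this
  exact ⟨d, fun ρ => hd _ ρ rfl⟩

include hQ hN hM in
-- Far enough out, `hM.split` permits every node to be hit, and intersecting the slalom with the
-- complement of the marked points permits every node to be missed. Thus `exists_bits_eq` supplies
-- the reductions.
theorem sameGeneric [∀ n, Nontrivial (H n)] {c : Bool}
    {τ : StdName Q (fun _ : ℕ => Bool)} (hτ : ∀ p n, bound pos e n ≤ (w p).len →
      ∃ x, x.1.1 = bits pos a e c (w p) n ∧ τ.q x ≤ p) : SameGeneric cohenReal τ := by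
  have hmem : ∀ p η, bound pos e η.len ≤ (w p).len → bits pos a e c (w p) η.len = η →
      p ∈ (τ.initVal η).1 := by
    intro p η h1 h2
    obtain ⟨x, hx, hxp⟩ := hτ p _ h1
    exact τ.mem_initVal_of_le (hx.trans h2) hxp
  apply sameGeneric_cohenReal
  · intro η
    -- With empty stem and full slalom all bits are free from index 0 on, so every η is possible.
    obtain ⟨p, hp, hpS⟩ := hQ.exists_mk ⟨0, fun i => i.elim0⟩ (fun _ => Set.univ)
      ⟨hN.univ_mem, hM.univ _⟩ fun _ _ => univ_nonempty
    obtain ⟨η₀, h0, hη⟩ := hQ.exists_bits_eq hM (e := e) c p 0 fun i _ => ⟨⟨true, by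
      rw [hpS _ (Nat.zero_le _)]; trivial⟩, fun b => ⟨by rw [hp]; exact Nat.zero_le _, by
      rw [hpS _ (Nat.zero_le _)]
      obtain ⟨v, hv⟩ := exists_ne (a ((e i).snoc b) (pos ((e i).snoc b)))
      exact ⟨v, trivial, hv⟩⟩⟩
    obtain ⟨q, -, h1, h2⟩ := hη η
      (FinSeq.le_def.2 ⟨h0 ▸ Nat.zero_le _, fun i hi => absurd hi (by omega)⟩)
    exact ⟨q, hmem q η h1 h2⟩
  · intro p
    obtain ⟨d, hd⟩ := exists_point (a := a) hM.injective
    obtain ⟨l, hl⟩ := hM.split _ _ (hQ.mem p).2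
    obtain ⟨m, hm⟩ := eventually_atTop.1
      (hN.inter_nonempty _ (hQ.mem p).1 _ (hN.compl_singleton d))
    obtain ⟨i₀, hi₀⟩ := exists_forall_le_len e (max l (max m (w p).len))
    obtain ⟨η, -, hη⟩ := hQ.exists_bits_eq hM (e := e) c p i₀ fun i hi => by
      have h1 := hi₀ i hi
      have h2 : ∀ b, (e i).len < pos ((e i).snoc b) := fun b => hM.len_le ((e i).snoc b)
      have h3 : ∀ b, (w p).len ≤ pos ((e i).snoc b) := fun b => by
        have := h2 b
        omega
      constructor
      · obtain ⟨b, hb⟩ := hl (e i) (by omega)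
        exact ⟨b, hb (h3 b)⟩
      · refine fun b => ⟨h3 b, ?_⟩
        rw [← hd, sdiff_eq]
        exact hm _ (by have := h2 b; omega)
    refine ⟨η, fun η' h' => ?_⟩
    obtain ⟨q, hpq, h1, h2⟩ := hη η' h'
    exact ⟨q, hpq, hmem q η' h1 h2⟩

include hQ hM in
theorem forces_of_forall [∀ n, Nonempty (H n)] {c : Bool}
    {τ : StdName Q (fun _ : ℕ => Bool)} (hτ : ∀ p n, bound pos e n ≤ (w p).len →
      ∃ x, x.1.1 = bits pos a e c (w p) n ∧ τ.q x ≤ p) {q : Q} {n : ℕ}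
    {A : Set (Fin n → Bool)}
    (h : ∀ s, q ≤ s → bound pos e n ≤ (w s).len → (bits pos a e c (w s) n).val ∈ A) :
    τ.Forces q n A := by
  intro r hr
  obtain ⟨s, hs, hsl, -⟩ := hQ.exists_len_eq hM r (le_max_left (w r).len (bound pos e n))
  have hb : bound pos e n ≤ (w s).len := hsl ▸ le_max_right _ _
  obtain ⟨x, hx, hxs⟩ := hτ s n hb
  exact ⟨s, hs, _, ⟨x, ⟨_, h s (hr.trans hs) hb, hx⟩, rfl⟩, hxs⟩

/-- The bound on lengths places the k-th stem below every position attached to a node of length at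
least k; repetitions in the enumeration make room for it. -/
theorem exists_enum [∀ n, Countable (H n)] :
    ∃ u : ℕ → FinSeq H, (∀ k, (u k).len ≤ k) ∧ ∀ v, ∃ k, u k = v := by
  have : Nonempty (FinSeq H) := ⟨⟨0, fun i => i.elim0⟩⟩
  obtain ⟨g, hg⟩ := exists_surjective_nat (FinSeq H)
  refine ⟨fun k => (g k.unpair.1).take k, fun k => min_le_left _ _, fun v => ?_⟩
  obtain ⟨j, rfl⟩ := hg v
  refine ⟨Nat.pair j (g j).len, ?_⟩
  simp only [Nat.unpair_pair]
  exact FinSeq.take_eq_self (Nat.right_le_pair _ _)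

include hN in
theorem avoidBranch_mem [∀ n, Nonempty (H n)] (h : Function.Injective pos) (x : ℕ → Bool) :
    avoidBranch pos a x ∈ N := by
  obtain ⟨d, hd⟩ := exists_point (a := a) h
  refine hN.mono _ (hN.compl_singleton d) _ (Eventually.of_forall fun n v hv => ?_)
  rintro ρ - rfl rfl
  exact hv (hd ρ).symm

theorem avoidBranch_nonempty [∀ n, Nontrivial (H n)] (h : Function.Injective pos) (x : ℕ → Bool)
    (n : ℕ) : (avoidBranch pos a x n).Nonempty := by
  obtain ⟨d, hd⟩ := exists_point (a := a) h
  obtain ⟨v, hv⟩ := exists_ne (d n)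
  refine ⟨v, ?_⟩
  rintro ρ - rfl rfl
  exact hv (hd ρ).symm

theorem isClopen_initSeg (ρ : BinSeq) : IsClopen {x : ℕ → Bool | InitSeg ρ x} := by
  have : {x : ℕ → Bool | InitSeg ρ x} = ⋂ i : Fin ρ.len, {x | x i = ρ.val i} := by
    ext x
    rw [mem_iInter]
    exact FinSeq.initSeg_iff.trans ⟨fun h i => h i i.2, fun h i hi => h ⟨i, hi⟩⟩
  rw [this]
  exact isClopen_iInter_of_finite fun i =>
    (isClopen_discrete {ρ.val i}).preimage (continuous_apply (i : ℕ))

/-- Whether `v` is omitted at `n` depends on at most one ρ, hence on finitely many bits of x; this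
makes the map g continuous. -/
theorem isClopen_mem_avoidBranch (h : Function.Injective pos) (n : ℕ) (v : H n) :
    IsClopen {x | v ∈ avoidBranch pos a x n} := by
  by_cases hn : ∃ ρ, pos ρ = n ∧ v = a ρ n
  · obtain ⟨ρ, rfl, hv⟩ := hn
    convert (isClopen_initSeg ρ).compl using 1
    ext x
    constructor
    · intro hx hρ
      exact hx ρ hρ rfl hv
    · intro hx ρ' hρ' hh
      rw [h hh] at hρ'
      exact absurd hρ' hx
  · convert isClopen_univ using 1
    rw [eq_univ_iff_forall]
    rintro x ρ - hρ hv
    exact hn ⟨ρ, hρ, hv⟩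

open Classical in
/-- The real coding a condition. -/
noncomputable def toReal (w : Q → FinSeq H) (S : Q → (n : ℕ) → Set (H n)) (p : Q) :
    FinSeq H × ((n : ℕ) → H n → Bool) :=
  (w p, fun n v => decide (v ∈ S p n))

omit [Preorder Q] in
theorem toReal_injective (hext : ∀ p q : Q, w p = w q → S p = S q → p = q) :
    Function.Injective (toReal w S) := by
  intro p q h
  refine hext p q (congrArg Prod.fst h) ?_
  funext n
  ext v
  have := congrFun (congrFun (congrArg Prod.snd h) n) v
  simpa [toReal] using this

open Classical in
include hQ in
theorem continuous_toReal {g : (ℕ → Bool) × ℕ → Q} {u : ℕ → FinSeq H}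
    (hinj : Function.Injective pos) (hg : ∀ z, w (g z) = u z.2)
    (hgS : ∀ z n, (u z.2).len ≤ n → S (g z) n = avoidBranch pos a z.1 n) :
    Continuous fun z => toReal w S (g z) := by
  refine Continuous.prodMk ?_ (continuous_pi fun n => continuous_pi fun v => ?_)
  · simp only [hg]
    exact continuous_of_discreteTopology.comp continuous_snd
  · rw [continuous_bool_rng true]
    have : (fun z => decide (v ∈ S (g z) n)) ⁻¹' {true} =
        (Prod.snd ⁻¹' {k | (u k).len ≤ n}) ∩ (Prod.fst ⁻¹' {x | v ∈ avoidBranch pos a x n}) := by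
      ext z
      simp only [mem_preimage, mem_singleton_iff, decide_eq_true_eq, mem_inter_iff, mem_ofPred_eq]
      rcases lt_or_ge n (u z.2).len with h | h
      · rw [hQ.empty _ _ (by rwa [hg])]
        simp [h.not_ge]
      · rw [hgS z n h]
        simp [h]
    rw [this]
    exact ((isClopen_discrete _).preimage continuous_snd).inter
      ((isClopen_mem_avoidBranch hinj n v).preimage continuous_fst)

include hQ hN hM in
-- One map g serves both names. A condition above g(x₀,k) and g(x₁,k) cannot hit the node where x₀
-- and x₁ split, and the two names report this by opposite bits.
theorem veryExplicitlySourOver [∀ n, Countable (H n)] [∀ n, Nontrivial (H n)]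
    (hext : ∀ p q : Q, w p = w q → S p = S q → p = q) :
    VeryExplicitlySourOver cohenReal (toReal w S) := by
  obtain ⟨e⟩ : Nonempty (ℕ ≃ BinSeq) :=
    (nonempty_denumerable BinSeq).map fun h => (@Denumerable.eqv BinSeq h).symm
  choose τ hτ using hQ.exists_name hN hM e
  refine ⟨toReal_injective hext, hQ.ccc hN hM, τ false, τ true,
    hQ.sameGeneric hN hM (hτ false), hQ.sameGeneric hN hM (hτ true), ?_⟩
  obtain ⟨u, hul, hu⟩ := exists_enum (H := H)
  choose g hgw hgS using fun z : (ℕ → Bool) × ℕ => hQ.exists_mk (u z.2) (avoidBranch pos a z.1)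
    ⟨avoidBranch_mem hN hM.injective _, hM.avoidBranch _ _⟩
    fun n _ => avoidBranch_nonempty hM.injective _ n
  have hmeas := (hQ.continuous_toReal hM.injective hgw hgS).borel_measurable
  have hpre : ∀ x, Predense (Set.range fun n => g (x, n)) := by
    intro x p
    -- Beyond m the two slaloms meet at each coordinate, so it suffices to lengthen the stem of `p`
    -- past m and to use its number k in the enumeration of stems.
    obtain ⟨m, hm⟩ := eventually_atTop.1 (hN.inter_nonempty _
      (avoidBranch_mem (a := a) hN hM.injective x) _ (hQ.mem p).1)
    obtain ⟨q, hpq, hq, hqS⟩ := hQ.exists_len_eq hM p (le_max_left (w p).len m)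
    obtain ⟨k, hk⟩ := hu (w q)
    refine ⟨_, ⟨k, rfl⟩, ?_⟩
    have hw : w (g (x, k)) = w q := (hgw _).trans hk
    obtain ⟨r, h1, h2⟩ := hQ.compat_of_eq hN hM hw fun n hn => by
      rw [hgS _ n (hk ▸ hn), hqS n (hq ▸ hn)]
      exact hm n ((le_max_right _ _).trans (hq ▸ hn))
    exact ⟨r, h1, hpq.trans h2⟩
  refine ⟨g, g, hmeas, hmeas, hpre, hpre, ?_⟩
  intro x₀ x₁ hne m k₀ k₁ hm hk₀ hk₁
  obtain ⟨j, hj, hjmin⟩ : ∃ j, x₀ j ≠ x₁ j ∧ ∀ i < j, x₀ i = x₁ i := by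
    have h : ∃ j, x₀ j ≠ x₁ j := Function.ne_iff.1 hne
    exact ⟨Nat.find h, Nat.find_spec h, fun i hi => not_not.1 (Nat.find_min h hi)⟩
  have hmj : m ≤ j := by
    by_contra! h
    exact hj (FinSeq.le_def.1 hm.ge |>.2 j h h)
  let σ : BinSeq := restr x₀ j
  have h0 : InitSeg (σ.snoc (x₀ j)) x₀ := FinSeq.initSeg_snoc.2 ⟨rfl, rfl⟩
  have h1 : InitSeg (σ.snoc (x₁ j)) x₁ := FinSeq.initSeg_snoc.2
    ⟨FinSeq.initSeg_iff.2 fun i hi => (hjmin i hi).symm, rfl⟩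
  -- The position of σ⌢b is at least j + 1 > k, hence past the stem of g(x, k). Each σ⌢b is an
  -- initial segment of x₀ or x₁, so its marked point is omitted by one of the two conditions.
  have key : ∀ k < m, ∀ s, g (x₀, k) ≤ s → g (x₁, k) ≤ s → ¬ Hit pos a (w s) σ := by
    rintro k hk s hs₀ hs₁ ⟨b, hb, hab⟩
    have hpos : k < pos (σ.snoc b) :=
      (hk.trans_le hmj).trans_le ((Nat.le_succ j).trans (hM.len_le (σ.snoc b)))
    have main : ∀ x, InitSeg (σ.snoc b) x → g (x, k) ≤ s → False := by
      intro x hx hs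
      have h2 := ((hQ.le_iff _ _).1 hs).2.1 _ hb (by rw [hgw]; exact (hul k).trans hpos.le)
      rw [hgS _ _ ((hul k).trans hpos.le)] at h2
      exact h2 _ hx rfl hab
    by_cases hbx : b = x₀ j
    · exact main x₀ (hbx ▸ h0) hs₀
    · have : b = x₁ j := by
        revert hbx hj
        cases b <;> cases x₀ j <;> cases x₁ j <;> simp
      exact main x₁ (this ▸ h1) hs₁
  obtain ⟨i, hi⟩ := e.surjective σ
  -- Only the bit of σ = `e i` matters, so i + 1 bits suffice.
  refine ⟨i + 1, {η | η (Fin.last i) = false}, {η | η (Fin.last i) = true}, ?_, ?_, ?_⟩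
  · rw [Set.disjoint_left]
    intro η h h'
    exact absurd (h.symm.trans h') (by simp)
  · intro q hq₀ hq₁
    refine hQ.forces_of_forall hM (hτ false) fun s hs _ => ?_
    have := key k₀ hk₀ s (hq₀.trans hs) (hq₁.trans hs)
    rw [← hi] at this
    refine Eq.trans (bits_val (h := Nat.lt_succ_self i)) ?_
    simp [this]
  · intro q hq₀ hq₁
    refine hQ.forces_of_forall hM (hτ true) fun s hs _ => ?_
    have := key k₁ hk₁ s (hq₀.trans hs) (hq₁.trans hs)
    rw [← hi] at this
    refine Eq.trans (bits_val (h := Nat.lt_succ_self i)) ?_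
    simp [this]

end IsSlalom

/-! ### Definability of the forcing notions -/

theorem MeasureTheory.AnalyticSet.inter {α : Type*} [TopologicalSpace α] [T2Space α] {s t : Set α}
    (hs : AnalyticSet s) (ht : AnalyticSet t) : AnalyticSet (s ∩ t) := by
  rw [inter_eq_iInter]
  exact AnalyticSet.iInter fun b => by cases b <;> assumption

instance polishSpace_pi_pi_bool {H : ℕ → Type*} [∀ n, Countable (H n)] :
    PolishSpace ((n : ℕ) → H n → Bool) := { }

namespace IsSlalom

variable {H : ℕ → Type*} {Q : Type*} [Preorder Q] {w : Q → FinSeq H}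
  {S : Q → (n : ℕ) → Set (H n)}
  {N : Set ((n : ℕ) → Set (H n))} {M : ℕ → Set ((n : ℕ) → Set (H n))}
  {pos : BinSeq → ℕ} {a : BinSeq → (n : ℕ) → H n}

/-- The slalom given by characteristic functions. -/
def ofChar (χ : (n : ℕ) → H n → Bool) (n : ℕ) : Set (H n) := {v | χ n v = true}

omit [Preorder Q] in
theorem ofChar_toReal (p : Q) : ofChar (toReal w S p).2 = S p := by
  funext n
  ext v
  simp [ofChar, toReal]

theorem measurable_apply_eq_true (n : ℕ) (v : H n) :
    Measurable fun χ : (n : ℕ) → H n → Bool => χ n v = true := by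
  rw [← measurableSet_setOfPred]
  have h : Measurable fun χ : (n : ℕ) → H n → Bool => χ n v := by fun_prop
  exact h (measurableSet_singleton true)

variable (hQ : IsSlalom w S (normInter N M)) (hN : NormBase N) (hM : BranchNorm pos a M)

include hQ in
theorem mem_range_toReal {z : FinSeq H × ((n : ℕ) → H n → Bool)} :
    z ∈ Set.range (toReal w S) ↔ ((∀ n v, n < z.1.len → ¬ z.2 n v = true) ∧
      ∀ n, z.1.len ≤ n → ∃ v, z.2 n v = true) ∧ ofChar z.2 ∈ N ∧ ofChar z.2 ∈ M z.1.len := by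
  constructor
  · rintro ⟨p, rfl⟩
    rw [ofChar_toReal]
    refine ⟨⟨fun n v hn hv => ?_, fun n hn => ?_⟩, hQ.mem p⟩
    · have : v ∈ S p n := by simpa [toReal] using hv
      rwa [hQ.empty p n hn] at this
    · obtain ⟨v, hv⟩ := hQ.nonempty p n hn
      exact ⟨v, by simpa [toReal] using hv⟩
  · rintro ⟨⟨h1, h2⟩, h3⟩
    obtain ⟨p, hp, hpS⟩ := hQ.exists_mk z.1 (ofChar z.2) h3 h2
    refine ⟨p, Prod.ext hp ?_⟩
    funext n v
    have : v ∈ S p n ↔ z.2 n v = true := by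
      rcases lt_or_ge n z.1.len with hn | hn
      · rw [hQ.empty p n (hp ▸ hn)]
        simp [h1 n v hn]
      · rw [hpS n hn]
        rfl
    simp [toReal, this]

/-- There are only countably many stems, so complexity can be computed with the stem fixed. -/
theorem analyticSet_of_slices {X Y : Type*} [TopologicalSpace X] [DiscreteTopology X] [Countable X]
    [TopologicalSpace Y] [PolishSpace Y] {P : Set (X × Y)}
    (h : ∀ x, AnalyticSet {y | (x, y) ∈ P}) : AnalyticSet P := by
  have : P = ⋃ x, Prod.mk x '' {y | (x, y) ∈ P} := by
    ext ⟨x, y⟩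
    simp
  rw [this]
  exact AnalyticSet.iUnion fun x => (h x).image_of_continuous (by fun_prop)

include hQ in
theorem analyticSet_range_toReal [∀ n, Countable (H n)]
    (hNA : AnalyticSet {χ : (n : ℕ) → H n → Bool | ofChar χ ∈ N})
    (hMA : ∀ m, AnalyticSet {χ : (n : ℕ) → H n → Bool | ofChar χ ∈ M m}) :
    AnalyticSet (Set.range (toReal w S)) := by
  refine analyticSet_of_slices fun u => ?_
  simp only [hQ.mem_range_toReal]
  refine AnalyticSet.inter (MeasurableSet.analyticSet (s := {χ : (n : ℕ) → H n → Bool |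
    (∀ n v, n < u.len →
    ¬ χ n v = true) ∧ ∀ n, u.len ≤ n → ∃ v, χ n v = true}) ?_) (hNA.inter (hMA _))
  rw [measurableSet_setOfPred]
  exact (Measurable.forall fun n => Measurable.forall fun v =>
    measurable_const.imp (measurable_apply_eq_true n v).not).and
    (Measurable.forall fun n => measurable_const.imp
      (Measurable.exists fun v => measurable_apply_eq_true n v))

omit [Preorder Q] in
-- A relation that is Borel in the slaloms for fixed stems is cut down to the analytic set of codes
-- in both coordinates.
theorem analyticSet_of_relation [∀ n, Countable (H n)]
    (hr : AnalyticSet (Set.range (toReal w S)))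
    {P : FinSeq H → FinSeq H → ((n : ℕ) → H n → Bool) × ((n : ℕ) → H n → Bool) → Prop}
    (hP : ∀ u v, MeasurableSet {z | P u v z}) {R : Q → Q → Prop}
    (hR : ∀ p q, R p q ↔ P (w p) (w q) ((toReal w S p).2, (toReal w S q).2)) :
    AnalyticSet {z | ∃ p q, R p q ∧ (toReal w S p, toReal w S q) = z} := by
  let Y := FinSeq H × ((n : ℕ) → H n → Bool)
  have : PolishSpace (Y × Y) := inferInstanceAs (PolishSpace
    ((FinSeq H × ((n : ℕ) → H n → Bool)) × (FinSeq H × ((n : ℕ) → H n → Bool))))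
  have h1 : AnalyticSet {z : Y × Y | P z.1.1 z.2.1 (z.1.2, z.2.2)} := by
    let F : (FinSeq H × FinSeq H) × (((n : ℕ) → H n → Bool) × ((n : ℕ) → H n → Bool)) → Y × Y :=
      fun z => ((z.1.1, z.2.1), (z.1.2, z.2.2))
    have h2 : AnalyticSet {z : (FinSeq H × FinSeq H) ×
        (((n : ℕ) → H n → Bool) × ((n : ℕ) → H n → Bool)) | P z.1.1 z.1.2 z.2} :=
      analyticSet_of_slices fun x => (hP x.1 x.2).analyticSet
    convert h2.image_of_continuous (f := F) (by fun_prop) using 1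
    ext ⟨⟨u, χ⟩, ⟨v, χ'⟩⟩
    constructor
    · intro h
      exact ⟨((u, v), (χ, χ')), h, rfl⟩
    · rintro ⟨⟨⟨u, v⟩, ⟨χ, χ'⟩⟩, h, h'⟩
      cases h'
      exact h
  convert ((hr.preimage (continuous_fst (X := Y) (Y := Y))).inter
    (hr.preimage (continuous_snd (X := Y) (Y := Y)))).inter h1 using 1
  ext z
  constructor
  · rintro ⟨p, q, h, rfl⟩
    exact ⟨⟨⟨p, rfl⟩, ⟨q, rfl⟩⟩, (hR p q).1 h⟩
  · rintro ⟨⟨⟨p, hp⟩, ⟨q, hq⟩⟩, h⟩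
    refine ⟨p, q, (hR p q).2 ?_, Prod.ext hp hq⟩
    change P z.1.1 z.2.1 (z.1.2, z.2.2) at h
    rw [← hp, ← hq] at h
    exact h

include hQ in
theorem le_iff_toReal {p q : Q} : p ≤ q ↔ w p ≤ w q ∧
    (∀ n (h : n < (w q).len), (w p).len ≤ n → (toReal w S p).2 n ((w q).val ⟨n, h⟩) = true) ∧
    ∀ n v, (w q).len ≤ n → (toReal w S q).2 n v = true → (toReal w S p).2 n v = true := by
  rw [hQ.le_iff]
  simp only [toReal, decide_eq_true_eq]
  exact and_congr_right fun _ => and_congr_right fun _ =>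
    forall_congr' fun n => ⟨fun h v hn hv => h hn hv, fun h hn v hv => h v hn hv⟩

include hQ hN hM in
theorem compat_iff_toReal [∀ n, Nonempty (H n)] {p q : Q} (hpq : (w p).len ≤ (w q).len) :
    Compat p q ↔ w p ≤ w q ∧
    (∀ n (h : n < (w q).len), (w p).len ≤ n → (toReal w S p).2 n ((w q).val ⟨n, h⟩) = true) ∧
    ∀ n, (w q).len ≤ n → ∃ v, (toReal w S p).2 n v = true ∧ (toReal w S q).2 n v = true := by
  rw [hQ.compat_iff hN hM hpq]
  simp only [toReal, decide_eq_true_eq]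
  rfl

theorem compat_comm {p q : Q} : Compat p q ↔ Compat q p :=
  ⟨fun ⟨r, h, h'⟩ => ⟨r, h', h⟩, fun ⟨r, h, h'⟩ => ⟨r, h', h⟩⟩

include hQ hN hM in
theorem isSouslin [∀ n, Countable (H n)] [∀ n, Nonempty (H n)]
    (hext : ∀ p q : Q, w p = w q → S p = S q → p = q)
    (hNA : AnalyticSet {χ : (n : ℕ) → H n → Bool | ofChar χ ∈ N})
    (hMA : ∀ m, AnalyticSet {χ : (n : ℕ) → H n → Bool | ofChar χ ∈ M m}) :
    IsSouslin (toReal w S) := by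
  have hr := hQ.analyticSet_range_toReal hNA hMA
  let Z := ((n : ℕ) → H n → Bool) × ((n : ℕ) → H n → Bool)
  have m1 : ∀ n v, Measurable fun z : Z => z.1 n v = true := fun n v =>
    (measurable_apply_eq_true n v).comp measurable_fst
  have m2 : ∀ n v, Measurable fun z : Z => z.2 n v = true := fun n v =>
    (measurable_apply_eq_true n v).comp measurable_snd
  refine ⟨toReal_injective hext, hr, ?_, ?_⟩
  · refine analyticSet_of_relation hr (P := fun u u' z => u ≤ u' ∧
      (∀ n (h : n < u'.len), u.len ≤ n → z.1 n (u'.val ⟨n, h⟩) = true) ∧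
      ∀ n v, u'.len ≤ n → z.2 n v = true → z.1 n v = true) (fun u u' => ?_)
      fun p q => hQ.le_iff_toReal
    refine (measurableSet_setOfPred (α := Z)).2 ?_
    exact measurable_const.and ((Measurable.forall fun n => Measurable.forall fun h =>
      measurable_const.imp (m1 _ _)).and (Measurable.forall fun n => Measurable.forall fun v =>
      measurable_const.imp ((m2 _ _).imp (m1 _ _))))
  -- The criterion for compatibility presupposes which stem is shorter; both cases are stated and
  -- negated, so incompatibility is Borel on codes.
  · refine analyticSet_of_relation hr (P := fun u u' z =>
      (u.len ≤ u'.len → ¬ (u ≤ u' ∧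
        (∀ n (h : n < u'.len), u.len ≤ n → z.1 n (u'.val ⟨n, h⟩) = true) ∧
        ∀ n, u'.len ≤ n → ∃ v, z.1 n v = true ∧ z.2 n v = true)) ∧
      (u'.len ≤ u.len → ¬ (u' ≤ u ∧
        (∀ n (h : n < u.len), u'.len ≤ n → z.2 n (u.val ⟨n, h⟩) = true) ∧
        ∀ n, u.len ≤ n → ∃ v, z.2 n v = true ∧ z.1 n v = true))) (fun u u' => ?_)
      fun p q => ?_
    · refine (measurableSet_setOfPred (α := Z)).2 ?_
      exact (measurable_const.imp (measurable_const.and ((Measurable.forall fun n =>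
          Measurable.forall fun h => measurable_const.imp (m1 _ _)).and
          (Measurable.forall fun n => measurable_const.imp
            (Measurable.exists fun v => (m1 _ _).and (m2 _ _))))).not).and
        (measurable_const.imp (measurable_const.and ((Measurable.forall fun n =>
          Measurable.forall fun h => measurable_const.imp (m2 _ _)).and
          (Measurable.forall fun n => measurable_const.imp
            (Measurable.exists fun v => (m2 _ _).and (m1 _ _))))).not)
    · constructor
      · intro h
        exact ⟨fun hl => (hQ.compat_iff_toReal hN hM hl).not.1 h,
          fun hl => (hQ.compat_iff_toReal hN hM hl).not.1 (compat_comm.not.1 h)⟩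
      · rintro ⟨h1, h2⟩
        rcases le_total (w p).len (w q).len with hl | hl
        · exact (hQ.compat_iff_toReal hN hM hl).not.2 (h1 hl)
        · exact compat_comm.not.1 ((hQ.compat_iff_toReal hN hM hl).not.2 (h2 hl))

end IsSlalom

namespace CreatingPair

variable {H : ℕ → Type*} {D : Type*}

/-! ### Norm conditions for slaloms -/

def slalomInf (C : CreatingPair H D) : Set ((n : ℕ) → Set (H n)) :=
  {A | Tendsto (fun n => C.norAt n (A n)) atTop atTop}

def slalomFun (C : CreatingPair H D) (f : ℕ → ℕ → ℕ) : Set ((n : ℕ) → Set (H n)) :=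
  {A | ∀ k, ∀ᶠ n in atTop, (f k n : ℝ) ≤ C.norAt n (A n)}

def slalomFam (C : CreatingPair H D) (F : Set (ℕ → ℕ)) : Set ((n : ℕ) → Set (H n)) :=
  {A | ∃ f ∈ F, ∀ᶠ n in atTop, (f n : ℝ) ≤ C.norAt n (A n)}

variable {C : CreatingPair H D}

theorem eventually_atTop_add {P : ℕ → Prop} (m : ℕ) :
    (∀ᶠ i in atTop, P (m + i)) ↔ ∀ᶠ n in atTop, P n := by
  rw [eventually_atTop, eventually_atTop]
  constructor
  · rintro ⟨b, h⟩
    refine ⟨m + b, fun n hn => ?_⟩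
    obtain ⟨i, rfl⟩ := Nat.exists_eq_add_of_le ((Nat.le_add_right m b).trans hn)
    exact h i (by omega)
  · rintro ⟨b, h⟩
    exact ⟨b, fun i hi => h _ (by omega)⟩

theorem tendsto_atTop_add {f : ℕ → ℝ} (m : ℕ) :
    Tendsto (fun i => f (m + i)) atTop atTop ↔ Tendsto f atTop atTop := by
  rw [← tendsto_add_atTop_iff_nat (f := f) m]
  simp only [add_comm]

namespace Cond

theorem mem_normInf_iff (hl : C.Local) (hc : C.Complete) (p : C.Cond) :
    p.t ∈ normInf ↔ p.slalom ∈ C.slalomInf := by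
  simp only [normInf, slalomInf, mem_ofPred_eq, ← p.norAt_slalom hl hc]
  exact tendsto_atTop_add (f := fun n => C.norAt n (p.slalom n)) p.w.len

theorem mem_normFun_iff (hl : C.Local) (hc : C.Complete) (f : ℕ → ℕ → ℕ) (p : C.Cond) :
    p.t ∈ normFun f ↔ p.slalom ∈ C.slalomFun f := by
  simp only [normFun, slalomFun, mem_ofPred_eq, ← p.norAt_slalom hl hc, p.dn_t hl]
  exact forall_congr' fun k =>
    eventually_atTop_add (P := fun n => (f k n : ℝ) ≤ C.norAt n (p.slalom n)) p.w.len

theorem mem_normFam_iff (hl : C.Local) (hc : C.Complete) (F : Set (ℕ → ℕ)) (p : C.Cond) :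
    p.t ∈ normFam F ↔ p.slalom ∈ C.slalomFam F := by
  simp only [normFam, slalomFam, mem_ofPred_eq, ← p.norAt_slalom hl hc, p.dn_t hl]
  exact exists_congr fun f => and_congr_right fun _ =>
    eventually_atTop_add (P := fun n => (f n : ℝ) ≤ C.norAt n (p.slalom n)) p.w.len

end Cond

/-- The use of (γ): a slalom omitting one point per coordinate loses at most one unit of norm. -/
theorem norAt_univ_sub_one_le [∀ n, Nontrivial (H n)]
    (hγ : ∀ (n : ℕ) (A : Set (H n)) (a : H n), a ∈ A → (A \ {a}).Nonempty →
      1 < C.norAt n A → C.norAt n A - 1 ≤ C.norAt n (A \ {a}))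
    {n : ℕ} (d : H n) (h : 1 < C.norAt n Set.univ) :
    C.norAt n Set.univ - 1 ≤ C.norAt n {d}ᶜ := by
  rw [compl_eq_univ_sdiff]
  refine hγ n _ d trivial ?_ h
  obtain ⟨v, hv⟩ := exists_ne d
  exact ⟨v, trivial, hv⟩

theorem one_lt_of_tendsto {A : (n : ℕ) → Set (H n)} (h : A ∈ C.slalomInf) :
    ∀ᶠ n in atTop, 1 < C.norAt n (A n) :=
  h.eventually (eventually_gt_atTop 1)

theorem Linked.inter_nonempty (hl : C.Local) (hc : C.Complete) (h : C.Linked) {n : ℕ}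
    {A B : Set (H n)} (hA : 1 < C.norAt n A) (hB : 1 < C.norAt n B) : (A ∩ B).Nonempty := by
  refine nonempty_of_norAt_pos hl (lt_of_lt_of_le ?_ (h.norAt_inter hl hc hA hB))
  rw [sub_pos]
  exact lt_min hA hB

/-- The norm conditions which imply that the norms are eventually above `1` are σ-linked. -/
theorem Linked.exists_classes (hl : C.Local) (hc : C.Complete) (h : C.Linked)
    {N : Set ((n : ℕ) → Set (H n))} (hN : ∀ A ∈ N, ∀ᶠ n in atTop, 1 < C.norAt n (A n)) :
    ∃ E : ℕ → ℕ → Set ((n : ℕ) → Set (H n)),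
      (∀ A ∈ N, ∃ j m₀, ∀ m, m₀ ≤ m → A ∈ E j m) ∧
      ∀ j m, ∀ A ∈ E j m, ∀ B ∈ E j m, ∀ n, m ≤ n → (A n ∩ B n).Nonempty := by
  refine ⟨fun _ m => {A | ∀ n, m ≤ n → 1 < C.norAt n (A n)}, fun A hA => ?_,
    fun _ m A hA B hB n hn => h.inter_nonempty hl hc (hA n hn) (hB n hn)⟩
  obtain ⟨m₀, hm₀⟩ := eventually_atTop.1 (hN A hA)
  exact ⟨0, m₀, fun m hm n hn => hm₀ n (hm.trans hn)⟩

theorem normBase_slalomInf [∀ n, Nontrivial (H n)] (hl : C.Local) (hc : C.Complete)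
    (hγ : ∀ (n : ℕ) (A : Set (H n)) (a : H n), a ∈ A → (A \ {a}).Nonempty →
      1 < C.norAt n A → C.norAt n A - 1 ≤ C.norAt n (A \ {a}))
    (h : C.Linked) (hu : Tendsto (fun n => C.norAt n Set.univ) atTop atTop) :
    NormBase C.slalomInf where
  mono A hA B hAB := tendsto_atTop_mono' _ (hAB.mono fun n hn => norAt_mono hl hc hn) hA
  inter A hA B hB := by
    have hmin : Tendsto (fun n => min (C.norAt n (A n)) (C.norAt n (B n)) - 1) atTop atTop :=
      tendsto_atTop_add_const_right _ _ (tendsto_inf_atTop _ hA hB)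
    refine tendsto_atTop_mono' _ ?_ hmin
    filter_upwards [one_lt_of_tendsto hA, one_lt_of_tendsto hB] with n h1 h2
    exact h.norAt_inter hl hc h1 h2
  inter_nonempty A hA B hB := by
    filter_upwards [one_lt_of_tendsto hA, one_lt_of_tendsto hB] with n h1 h2
    exact h.inter_nonempty hl hc h1 h2
  compl_singleton d := by
    refine tendsto_atTop_mono' _ ?_ (tendsto_atTop_add_const_right _ (-1) hu)
    filter_upwards [hu.eventually (eventually_gt_atTop 1)] with n hn
    exact norAt_univ_sub_one_le hγ (d n) hn
  linked := h.exists_classes hl hc fun A hA => one_lt_of_tendsto hA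

theorem _root_.Fast.one_lt {f : ℕ → ℕ → ℕ} (hf : Fast f) (n : ℕ) : 1 < f 2 n := by
  have h0 := (hf 0 n).2
  have h1 := (hf 1 n).2
  norm_num at h0 h1
  omega

/-- Linkedness and (γ) each cost one unit of norm; passing from k to k + 1 in a fast function pays
for it. -/
theorem _root_.Fast.add_one_le {f : ℕ → ℕ → ℕ} (hf : Fast f) (k n : ℕ) :
    (f k n : ℝ) ≤ f (k + 1) n - 1 := by
  have h : f k n + 1 ≤ f (k + 1) n := by
    have := (hf k n).2
    omega
  have h' : ((f k n : ℝ) + 1) ≤ f (k + 1) n := by exact_mod_cast h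
  linarith

theorem one_lt_of_slalomFun {f : ℕ → ℕ → ℕ} (hf : Fast f) {A : (n : ℕ) → Set (H n)}
    (h : A ∈ C.slalomFun f) : ∀ᶠ n in atTop, 1 < C.norAt n (A n) := by
  filter_upwards [h 2] with n hn
  have : (1 : ℝ) < f 2 n := by exact_mod_cast hf.one_lt n
  exact this.trans_le hn

theorem normBase_slalomFun [∀ n, Nontrivial (H n)] (hl : C.Local) (hc : C.Complete)
    (hγ : ∀ (n : ℕ) (A : Set (H n)) (a : H n), a ∈ A → (A \ {a}).Nonempty →
      1 < C.norAt n A → C.norAt n A - 1 ≤ C.norAt n (A \ {a}))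
    (h : C.Linked) {f : ℕ → ℕ → ℕ} (hf : Fast f)
    (hu : ∀ n i, n ≤ i → (f n i : ℝ) ≤ C.norAt i Set.univ) : NormBase (C.slalomFun f) where
  mono A hA B hAB k := by
    filter_upwards [hA k, hAB] with n h1 h2
    exact h1.trans (norAt_mono hl hc h2)
  inter A hA B hB k := by
    filter_upwards [one_lt_of_slalomFun hf hA, one_lt_of_slalomFun hf hB, hA (k + 1), hB (k + 1)]
      with n h1 h2 h3 h4
    refine le_trans ?_ (h.norAt_inter hl hc h1 h2)
    exact (hf.add_one_le k n).trans (sub_le_sub_right (le_min h3 h4) _)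
  inter_nonempty A hA B hB := by
    filter_upwards [one_lt_of_slalomFun hf hA, one_lt_of_slalomFun hf hB] with n h1 h2
    exact h.inter_nonempty hl hc h1 h2
  compl_singleton d k := by
    -- The bound on the full sets at level k + 1 is available only from n = k + 1 on.
    filter_upwards [one_lt_of_slalomFun hf (A := fun _ => Set.univ)
      (fun k => eventually_atTop.2 ⟨k, fun n hn => hu k n hn⟩), eventually_ge_atTop (k + 1)]
      with n h1 h2
    exact (hf.add_one_le k n).trans ((sub_le_sub_right (hu _ _ h2) _).trans
      (norAt_univ_sub_one_le hγ (d n) h1))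
  linked := h.exists_classes hl hc fun A hA => one_lt_of_slalomFun hf hA

/-- Directedness brings two slaloms under a common f ∈ F, and h-closedness provides the smaller
function witnessing their intersection. Countability of F is what makes the linked classes countably
many. -/
theorem normBase_slalomFam [∀ n, Nontrivial (H n)] (hl : C.Local) (hc : C.Complete)
    (hγ : ∀ (n : ℕ) (A : Set (H n)) (a : H n), a ∈ A → (A \ {a}).Nonempty →
      1 < C.norAt n A → C.norAt n A - 1 ≤ C.norAt n (A \ {a}))
    {h : ℕ → ℕ → ℕ} (hh : C.HLinked h) (hr : Regressive h) {F : Set (ℕ → ℕ)}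
    (h2 : ∀ f ∈ F, ∀ n, 2 ≤ f n) (hcl : HClosed h F) (hcount : F.Countable) (hne : F.Nonempty)
    (hdir : GeDirected F) (hu : ∀ f ∈ F, ∀ᶠ n in atTop, (f n : ℝ) ≤ C.norAt n Set.univ) :
    NormBase (C.slalomFam F) := by
  have hinter : ∀ f ∈ F, ∀ n {A B : Set (H n)}, f n ≤ C.norAt n A → f n ≤ C.norAt n B →
      h n (f n) ≤ C.norAt n (A ∩ B) := fun f hf n A B => hh.norAt_inter hl hc (h2 f hf n)
  have hinter' : ∀ f ∈ F, ∀ n {A B : Set (H n)}, f n ≤ C.norAt n A → f n ≤ C.norAt n B →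
      (A ∩ B).Nonempty := fun f hf n A B hA hB => by
    refine nonempty_of_norAt_pos hl (lt_of_lt_of_le ?_ (hinter f hf n hA hB))
    exact_mod_cast ((hr n).1 (f n) (h2 f hf n)).1
  have hcommon : ∀ A ∈ C.slalomFam F, ∀ B ∈ C.slalomFam F, ∃ f ∈ F, ∀ᶠ n in atTop,
      (f n : ℝ) ≤ C.norAt n (A n) ∧ (f n : ℝ) ≤ C.norAt n (B n) := by
    rintro A ⟨f, hf, hA⟩ B ⟨f', hf', hB⟩
    obtain ⟨f'', hf'', hle⟩ := hdir f hf f' hf'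
    refine ⟨f'', hf'', ?_⟩
    filter_upwards [hA, hB, hle] with n h1 h2 h3
    have h4 : (f'' n : ℝ) ≤ f n := by exact_mod_cast h3.trans (min_le_left _ _)
    have h5 : (f'' n : ℝ) ≤ f' n := by exact_mod_cast h3.trans (min_le_right _ _)
    exact ⟨h4.trans h1, h5.trans h2⟩
  constructor
  · rintro A ⟨f, hf, hA⟩ B hAB
    refine ⟨f, hf, ?_⟩
    filter_upwards [hA, hAB] with n h1 h2
    exact h1.trans (norAt_mono hl hc h2)
  · intro A hA B hB
    obtain ⟨f, hf, hAB⟩ := hcommon A hA B hB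
    obtain ⟨f', hf', hle⟩ := hcl f hf
    refine ⟨f', hf', ?_⟩
    filter_upwards [hAB, hle] with n h1 h2
    exact le_trans (by exact_mod_cast h2) (hinter f hf n h1.1 h1.2)
  · intro A hA B hB
    obtain ⟨f, hf, hAB⟩ := hcommon A hA B hB
    filter_upwards [hAB] with n h1
    exact hinter' f hf n h1.1 h1.2
  · intro d
    obtain ⟨f, hf⟩ := hne
    obtain ⟨f', hf', hle⟩ := hcl f hf
    refine ⟨f', hf', ?_⟩
    filter_upwards [hu f hf, hle] with n h1 h3
    have h4 := h2 f hf n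
    have h5 := ((hr n).1 (f n) h4).2
    -- Since h is regressive, f' lies a full unit below f, which covers the loss in (γ).
    have h6 : (f' n : ℝ) + 1 ≤ f n := by exact_mod_cast (by omega : f' n + 1 ≤ f n)
    have h7 : (1 : ℝ) < f n := by exact_mod_cast h4
    have h8 := norAt_univ_sub_one_le hγ (d n) (h7.trans_le h1)
    change (f' n : ℝ) ≤ C.norAt n {d n}ᶜ
    linarith
  · obtain ⟨s, rfl⟩ := hcount.exists_eq_range hne
    refine ⟨fun j m => {A | ∀ n, m ≤ n → (s j n : ℝ) ≤ C.norAt n (A n)}, ?_,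
      fun j m A hA B hB n hn => hinter' _ ⟨j, rfl⟩ n (hA n hn) (hB n hn)⟩
    rintro A ⟨_, ⟨j, rfl⟩, hA⟩
    obtain ⟨m₀, hm₀⟩ := eventually_atTop.1 hA
    exact ⟨j, m₀, fun m hm n hn => hm₀ n (hm.trans hn)⟩

/-! ### Definability of the norm conditions -/

theorem BorelNorms.measurable [∀ n, Countable (H n)] (h : C.BorelNorms) (n : ℕ) :
    Measurable fun χ : (n : ℕ) → H n → Bool => C.norAt n (IsSlalom.ofChar χ n) := by
  have h1 : Measurable fun χ : H n → Bool => C.norAt n {a | χ a = true} := by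
    have := h n
    rwa [← BorelSpace.measurable_eq (α := H n → Bool)] at this
  exact h1.comp (measurable_pi_apply n)

theorem BorelNorms.measurable_le [∀ n, Countable (H n)] (h : C.BorelNorms) (r : ℝ) (n : ℕ) :
    Measurable fun χ : (n : ℕ) → H n → Bool => r ≤ C.norAt n (IsSlalom.ofChar χ n) :=
  measurableSet_setOfPred.1 (measurableSet_le measurable_const (h.measurable n))

theorem BorelNorms.measurable_eventually [∀ n, Countable (H n)] (h : C.BorelNorms) (r : ℕ → ℝ) :
    Measurable fun χ : (n : ℕ) → H n → Bool =>
      ∀ᶠ n in atTop, r n ≤ C.norAt n (IsSlalom.ofChar χ n) := by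
  simp only [eventually_atTop]
  exact Measurable.exists fun m => Measurable.forall fun n =>
    measurable_const.imp (h.measurable_le _ n)

theorem BorelNorms.analyticSet_slalomInf [∀ n, Countable (H n)] (h : C.BorelNorms) :
    AnalyticSet {χ : (n : ℕ) → H n → Bool | IsSlalom.ofChar χ ∈ C.slalomInf} := by
  have : ∀ χ : (n : ℕ) → H n → Bool, IsSlalom.ofChar χ ∈ C.slalomInf ↔
      ∀ k : ℕ, ∀ᶠ n in atTop, (k : ℝ) ≤ C.norAt n (IsSlalom.ofChar χ n) := by
    intro χ
    refine tendsto_atTop.trans ⟨fun h k => h k, fun h b => ?_⟩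
    obtain ⟨k, hk⟩ := exists_nat_ge b
    exact (h k).mono fun n hn => hk.trans hn
  simp only [this]
  exact (measurableSet_setOfPred.2
    (Measurable.forall fun k => h.measurable_eventually _)).analyticSet

theorem BorelNorms.analyticSet_slalomFun [∀ n, Countable (H n)] (h : C.BorelNorms)
    (f : ℕ → ℕ → ℕ) :
    AnalyticSet {χ : (n : ℕ) → H n → Bool | IsSlalom.ofChar χ ∈ C.slalomFun f} :=
  (measurableSet_setOfPred.2
    (Measurable.forall fun k => h.measurable_eventually fun n => (f k n : ℝ))).analyticSet

theorem BorelNorms.analyticSet_slalomFam [∀ n, Countable (H n)] (h : C.BorelNorms)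
    {F : Set (ℕ → ℕ)} (hF : F.Countable) :
    AnalyticSet {χ : (n : ℕ) → H n → Bool | IsSlalom.ofChar χ ∈ C.slalomFam F} := by
  have : {χ : (n : ℕ) → H n → Bool | IsSlalom.ofChar χ ∈ C.slalomFam F} = ⋃ f ∈ F,
      {χ | ∀ᶠ n in atTop, (f n : ℝ) ≤ C.norAt n (IsSlalom.ofChar χ n)} := by
    ext χ
    simp [slalomFam]
  rw [this]
  exact (MeasurableSet.biUnion hF fun f _ =>
    measurableSet_setOfPred.2 (h.measurable_eventually _)).analyticSet

end CreatingPair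

/-! ### The two kinds of norming systems -/

section Systems

variable {H : ℕ → Type*}

/-- The demand on slaloms given by a 1-norming system. -/
def slalomK (K : ℕ → Set ℕ) (g : BinSeq → (m : ℕ) → H m) (m : ℕ) : Set ((n : ℕ) → Set (H n)) :=
  {A | ∃ R : Set (ℕ → Bool), R.Finite ∧ ∀ (n : ℕ) (ρ : BinSeq), m ≤ n →
    n ∈ K ρ.len → g ρ n ∉ A n → ∃ x ∈ R, InitSeg ρ x}

/-- The demand on slaloms given by a 2-norming system. -/
def slalomU (U : BinSeq → ℕ → Set ℕ) (m : ℕ) : Set ((n : ℕ) → Set (H n)) :=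
  {A | ∃ (R : Set (ℕ → Bool)) (S : Set ℕ), R.Finite ∧ S.Finite ∧
    ∀ (n k : ℕ) (ρ : BinSeq), m ≤ n → n ∈ U ρ k → A n ≠ Set.univ →
      (∃ x ∈ R, InitSeg ρ x) ∧ k ∈ S}

/-- Disjointness of the K_ℓ makes lh(ρ) readable from a position, and an injection of 2^{<ω} into ω
separates the ρ of the same length. Omitting along x has exceptional set R = {x}; the splitting
property follows since for long σ some σ⌢b is on no branch in R. -/
theorem IsOneNorming.exists_branchNorm {K : ℕ → Set ℕ} {g : BinSeq → (m : ℕ) → H m}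
    (h : IsOneNorming K g) : ∃ pos, BranchNorm pos g (slalomK K g) := by
  obtain ⟨c, hc⟩ := exists_injective_nat BinSeq
  let ι := fun l => (h.infinite l).natEmbedding (K l)
  let pos : BinSeq → ℕ := fun ρ => ι ρ.len (c ρ)
  have hpos : ∀ ρ, pos ρ ∈ K ρ.len := fun ρ => (ι ρ.len (c ρ)).2
  have hlen : ∀ l l' n, n ∈ K l → n ∈ K l' → l = l' := fun l l' n hn hn' => by
    by_contra hne
    exact Set.disjoint_left.1 (h.disjoint hne) hn hn'
  refine ⟨pos, ⟨?_, fun ρ => h.le_min _ _ (hpos ρ), ?_, ?_, ?_, ?_, ?_, ?_⟩⟩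
  · intro ρ ρ' hρ
    have hl : ρ.len = ρ'.len := hlen _ _ (pos ρ) (hpos ρ) (hρ ▸ hpos ρ')
    change ((ι ρ.len (c ρ) : ℕ)) = ι ρ'.len (c ρ') at hρ
    rw [hl] at hρ
    exact hc ((ι ρ'.len).injective (Subtype.ext hρ))
  · rintro m A B hAB ⟨R, hR, hA⟩
    exact ⟨R, hR, fun n ρ hn hK hB => hA n ρ hn hK (by rwa [hAB n hn])⟩
  · rintro m m' hm A ⟨R, hR, hA⟩
    exact ⟨R, hR, fun n ρ hn => hA n ρ (hm.trans hn)⟩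
  · rintro m A ⟨R, hR, hA⟩ B ⟨R', hR', hB⟩
    refine ⟨R ∪ R', hR.union hR', fun n ρ hn hK hAB => ?_⟩
    by_cases hgA : g ρ n ∈ A n
    · obtain ⟨x, hx, hx'⟩ := hB n ρ hn hK fun hgB => hAB ⟨hgA, hgB⟩
      exact ⟨x, Or.inr hx, hx'⟩
    · obtain ⟨x, hx, hx'⟩ := hA n ρ hn hK hgA
      exact ⟨x, Or.inl hx, hx'⟩
  · exact fun m => ⟨∅, finite_empty, fun n ρ _ _ h => absurd trivial h⟩
  · refine fun m x => ⟨{x}, finite_singleton x, fun n ρ _ hK hg => ⟨x, rfl, ?_⟩⟩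
    simp only [avoidBranch, mem_ofPred_eq, not_forall, ne_eq, not_not] at hg
    -- Equal values of ḡ at a position in K_ℓ force equal indices, so the omitted point belongs to a
    -- ρ on x itself.
    obtain ⟨ρ', hρ', rfl, hgg⟩ := hg
    have hl := hlen _ _ _ hK (hpos ρ')
    rwa [h.inj _ _ hK ρ ρ' rfl hl.symm hgg]
  · rintro m A ⟨R, hR, hA⟩
    obtain ⟨l, hl⟩ := FinSeq.exists_forall_not_initSeg_snoc hR
    refine ⟨l, fun σ hσ => ?_⟩
    obtain ⟨b, hb⟩ := hl σ hσ
    refine ⟨b, fun hm => ?_⟩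
    by_contra hg
    obtain ⟨x, hx, hx'⟩ := hA _ _ hm (hpos _) hg
    exact hb x hx hx'

/-- One position is taken from each U_{ρ,0}, so that S = {0} suffices for `avoidBranch`. The marked
points may be arbitrary: off the exceptional branches the slalom has all values. -/
theorem IsTwoNorming.exists_branchNorm [∀ n, Nonempty (H n)] {U : BinSeq → ℕ → Set ℕ}
    (h : IsTwoNorming U) : ∃ pos, ∃ a : BinSeq → (m : ℕ) → H m,
      BranchNorm pos a (slalomU U) := by
  choose pos hpos using fun ρ => (h.infinite ρ 0).nonempty
  have huniq : ∀ x y : BinSeq × ℕ, ∀ n, n ∈ U x.1 x.2 → n ∈ U y.1 y.2 → x = y :=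
    fun x y n hn hn' => by
      by_contra hne
      exact Set.disjoint_left.1 (h.disjoint hne) hn hn'
  refine ⟨pos, fun _ _ => Classical.arbitrary _,
    ⟨?_, fun ρ => h.le_min _ _ _ (hpos ρ), ?_, ?_, ?_, ?_, ?_, ?_⟩⟩
  · intro ρ ρ' hρ
    exact congrArg Prod.fst (huniq (ρ, 0) (ρ', 0) _ (hpos ρ) (hρ ▸ hpos ρ'))
  · rintro m A B hAB ⟨R, S, hR, hS, hA⟩
    exact ⟨R, S, hR, hS, fun n k ρ hn hK hB => hA n k ρ hn hK (by rwa [hAB n hn])⟩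
  · rintro m m' hm A ⟨R, S, hR, hS, hA⟩
    exact ⟨R, S, hR, hS, fun n k ρ hn => hA n k ρ (hm.trans hn)⟩
  · rintro m A ⟨R, S, hR, hS, hA⟩ B ⟨R', S', hR', hS', hB⟩
    refine ⟨R ∪ R', S ∪ S', hR.union hR', hS.union hS', fun n k ρ hn hK hAB => ?_⟩
    by_cases hgA : A n = Set.univ
    · have hgB : B n ≠ Set.univ := fun hgB => hAB (by simp [hgA, hgB])
      obtain ⟨⟨x, hx, hx'⟩, hk⟩ := hB n k ρ hn hK hgB
      exact ⟨⟨x, Or.inr hx, hx'⟩, Or.inr hk⟩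
    · obtain ⟨⟨x, hx, hx'⟩, hk⟩ := hA n k ρ hn hK hgA
      exact ⟨⟨x, Or.inl hx, hx'⟩, Or.inl hk⟩
  · exact fun m => ⟨∅, ∅, finite_empty, finite_empty, fun n k ρ _ _ h => absurd rfl h⟩
  · refine fun m x => ⟨{x}, {0}, finite_singleton x, finite_singleton 0,
      fun n k ρ _ hK hg => ?_⟩
    rw [ne_eq, eq_univ_iff_forall] at hg
    simp only [avoidBranch, mem_ofPred_eq, not_forall, ne_eq, not_not] at hg
    obtain ⟨v, ρ', hρ', rfl, -⟩ := hg
    obtain ⟨rfl, rfl⟩ := Prod.mk.inj (huniq (ρ, k) (ρ', 0) _ hK (hpos ρ'))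
    exact ⟨⟨x, rfl, hρ'⟩, rfl⟩
  · rintro m A ⟨R, S, hR, -, hA⟩
    obtain ⟨l, hl⟩ := FinSeq.exists_forall_not_initSeg_snoc hR
    refine ⟨l, fun σ hσ => ?_⟩
    obtain ⟨b, hb⟩ := hl σ hσ
    refine ⟨b, fun hm => ?_⟩
    by_contra hg
    obtain ⟨⟨x, hx, hx'⟩, -⟩ := hA _ _ _ hm (hpos _) fun h => hg (h ▸ trivial)
    exact hb x hx hx'

/-- A finite set of reals is the range of a k-tuple for some k, so the set is a countable union of
projections of Borel sets. -/
theorem analyticSet_exists_finite {X ι : Type*} [TopologicalSpace X] [PolishSpace X]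
    [MeasurableSpace X] [BorelSpace X] [Countable ι] {B : ι → X → Prop}
    (hB : ∀ i, Measurable (B i)) (ρ : ι → BinSeq) :
    AnalyticSet {y | ∃ R : Set (ℕ → Bool), R.Finite ∧
      ∀ i, B i y → ∃ x ∈ R, InitSeg (ρ i) x} := by
  have : {y | ∃ R : Set (ℕ → Bool), R.Finite ∧ ∀ i, B i y → ∃ x ∈ R, InitSeg (ρ i) x} =
      ⋃ k : ℕ, Prod.fst '' {z : X × (Fin k → ℕ → Bool) |
        ∀ i, B i z.1 → ∃ j, InitSeg (ρ i) (z.2 j)} := by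
    ext y
    rw [mem_iUnion]
    constructor
    · rintro ⟨R, hR, h⟩
      obtain ⟨k, f, -, rfl⟩ := hR.fin_param
      refine ⟨k, (y, f), fun i hi => ?_, rfl⟩
      obtain ⟨_, ⟨j, rfl⟩, hj⟩ := h i hi
      exact ⟨j, hj⟩
    · rintro ⟨k, ⟨y, f⟩, h, rfl⟩
      refine ⟨Set.range f, finite_range f, fun i hi => ?_⟩
      obtain ⟨j, hj⟩ := h i hi
      exact ⟨_, ⟨j, rfl⟩, hj⟩
  rw [this]
  refine AnalyticSet.iUnion fun k => AnalyticSet.image_of_continuous ?_ continuous_fst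
  have : PolishSpace (X × (Fin k → ℕ → Bool)) := { }
  refine (measurableSet_setOfPred.2 ?_).analyticSet
  have hI : ∀ i, Measurable fun x : ℕ → Bool => InitSeg (ρ i) x := fun i =>
    measurableSet_setOfPred.1 (IsSlalom.isClopen_initSeg (ρ i)).isOpen.measurableSet
  exact Measurable.forall fun i => ((hB i).comp measurable_fst).imp (Measurable.exists fun j =>
    (hI i).comp ((measurable_pi_apply j).comp measurable_snd))

theorem analyticSet_slalomK [∀ n, Countable (H n)] (K : ℕ → Set ℕ)
    (g : BinSeq → (m : ℕ) → H m) (m : ℕ) :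
    AnalyticSet {χ : (n : ℕ) → H n → Bool | IsSlalom.ofChar χ ∈ slalomK K g m} := by
  convert analyticSet_exists_finite (X := (n : ℕ) → H n → Bool) (ι := ℕ × BinSeq)
    (B := fun i χ => m ≤ i.1 ∧ i.1 ∈ K i.2.len ∧ ¬ χ i.1 (g i.2 i.1) = true)
    (fun i => measurable_const.and (measurable_const.and
      (IsSlalom.measurable_apply_eq_true i.1 (g i.2 i.1)).not)) Prod.snd using 1
  ext χ
  refine exists_congr fun R => and_congr_right fun _ => ?_
  exact ⟨fun h i hi => h i.1 i.2 hi.1 hi.2.1 hi.2.2, fun h n ρ h1 h2 h3 => h (n, ρ) ⟨h1, h2, h3⟩⟩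

/-- The finite set S ranges over a countable set and contributes only a countable union; for each S
the demand on k is Borel. -/
theorem analyticSet_slalomU [∀ n, Countable (H n)] (U : BinSeq → ℕ → Set ℕ) (m : ℕ) :
    AnalyticSet {χ : (n : ℕ) → H n → Bool | IsSlalom.ofChar χ ∈ slalomU U m} := by
  have hm : ∀ i : ℕ × ℕ × BinSeq, Measurable fun χ : (n : ℕ) → H n → Bool =>
      m ≤ i.1 ∧ i.1 ∈ U i.2.2 i.2.1 ∧ ¬ ∀ v, χ i.1 v = true := fun i =>
    measurable_const.and (measurable_const.and
      (Measurable.forall fun v => IsSlalom.measurable_apply_eq_true i.1 v).not)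
  have huniv : ∀ (χ : (n : ℕ) → H n → Bool) n,
      IsSlalom.ofChar χ n ≠ Set.univ ↔ ¬ ∀ v, χ n v = true := fun χ n =>
    not_congr eq_univ_iff_forall
  convert AnalyticSet.iUnion (ι := Finset ℕ) fun S => (analyticSet_exists_finite hm
    (fun i => i.2.2)).inter (MeasurableSet.analyticSet (measurableSet_setOfPred.2
    (Measurable.forall fun i => (hm i).imp (measurable_const (a := i.2.1 ∈ S))))) using 1
  ext χ
  rw [mem_iUnion]
  constructor
  · rintro ⟨R, S, hR, hS, h⟩
    refine ⟨hS.toFinset, ⟨R, hR, fun i hi => ?_⟩, fun i hi => ?_⟩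
    · exact (h i.1 i.2.1 i.2.2 hi.1 hi.2.1 ((huniv χ _).2 hi.2.2)).1
    · exact hS.mem_toFinset.2 (h i.1 i.2.1 i.2.2 hi.1 hi.2.1 ((huniv χ _).2 hi.2.2)).2
  · rintro ⟨S, ⟨R, hR, h⟩, h'⟩
    refine ⟨R, S, hR, S.finite_toSet, fun n k ρ h1 h2 h3 => ?_⟩
    have hi := (huniv χ n).1 h3
    exact ⟨h (n, k, ρ) ⟨h1, h2, hi⟩, h' (n, k, ρ) ⟨h1, h2, hi⟩⟩

end Systems

/-! ### From creatures to slaloms, and the five cases -/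

namespace CreatingPair

variable {H : ℕ → Type*} {D : Type*} {C : CreatingPair H D}

namespace Cond

theorem exists_dn_eq (p : C.Cond) (hl : C.Local) {n : ℕ} (hn : p.w.len ≤ n) :
    ∃ i, (p.t i).dn = n :=
  ⟨n - p.w.len, by rw [p.dn_t hl]; omega⟩

theorem mem_modK_iff (hl : C.Local) {N : Set (ℕ → Creature H D)}
    {N' : Set ((n : ℕ) → Set (H n))} (hN : ∀ p : C.Cond, p.t ∈ N ↔ p.slalom ∈ N')
    (K : ℕ → Set ℕ) (g : BinSeq → (m : ℕ) → H m) (p : C.Cond) :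
    p.t ∈ modK K g N ↔ p.slalom ∈ normInter N' (slalomK K g) p.w.len := by
  refine and_congr (hN p) (exists_congr fun R => and_congr_right fun _ => ?_)
  constructor
  · intro h n ρ hn hK hg
    obtain ⟨i, rfl⟩ := p.exists_dn_eq hl hn
    rw [p.slalom_of_dn hl rfl] at hg
    exact h i ρ hK hg
  · intro h i ρ hK hg
    refine h _ ρ (by rw [p.dn_t hl]; omega) hK ?_
    rwa [p.slalom_of_dn hl rfl]

theorem mem_modU_iff (hl : C.Local) {N : Set (ℕ → Creature H D)}
    {N' : Set ((n : ℕ) → Set (H n))} (hN : ∀ p : C.Cond, p.t ∈ N ↔ p.slalom ∈ N')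
    (U : BinSeq → ℕ → Set ℕ) (p : C.Cond) :
    p.t ∈ modU U N ↔ p.slalom ∈ normInter N' (slalomU U) p.w.len := by
  refine and_congr (hN p) (exists_congr fun R => exists_congr fun S =>
    and_congr_right fun _ => and_congr_right fun _ => ?_)
  constructor
  · intro h n k ρ hn hK hg
    obtain ⟨i, rfl⟩ := p.exists_dn_eq hl hn
    rw [p.slalom_of_dn hl rfl] at hg
    exact h i k ρ hK hg
  · intro h i k ρ hK hg
    refine h _ k ρ (by rw [p.dn_t hl]; omega) hK ?_
    rwa [p.slalom_of_dn hl rfl]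

end Cond

/-- The forcing notions given by norm conditions on slaloms are very explicitly sour over Cohen,
and they are Souslin if the norms are Borel. -/
theorem sour_and_souslin [∀ n, Countable (H n)] [∀ n, Nontrivial (H n)]
    (hl : C.Local) (hf : C.Forgetful) (hc : C.Complete) {N : Set (ℕ → Creature H D)}
    {N' : Set ((n : ℕ) → Set (H n))} {M : ℕ → Set ((n : ℕ) → Set (H n))}
    {pos : BinSeq → ℕ} {a : BinSeq → (n : ℕ) → H n} (hN : NormBase N') (hM : BranchNorm pos a M)
    (h : ∀ p : C.Cond, p.t ∈ N ↔ p.slalom ∈ normInter N' M p.w.len)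
    (hNA : C.BorelNorms → AnalyticSet {χ : (n : ℕ) → H n → Bool | IsSlalom.ofChar χ ∈ N'})
    (hMA : ∀ m, AnalyticSet {χ : (n : ℕ) → H n → Bool | IsSlalom.ofChar χ ∈ M m}) :
    VeryExplicitlySourOver cohenReal (C.code N) ∧ (C.BorelNorms → IsSouslin (C.code N)) := by
  have hQ := isSlalom hl hf hc h fun m A B hAB hA =>
    ⟨hN.mono A hA.1 B (eventually_atTop.2 ⟨m, fun n hn => (hAB n hn).subset⟩),
      hM.congr m A B hAB hA.2⟩
  have hext : ∀ p q : C.Forcing N, p.1.w = q.1.w → p.1.slalom = q.1.slalom → p = q :=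
    fun p q hw hS => Subtype.ext (Cond.ext_of hl hc hw hS)
  exact ⟨hQ.veryExplicitlySourOver hN hM hext,
    fun hB => hQ.isSouslin hN hM hext (hNA hB) hMA⟩

end CreatingPair

theorem mainTheorem8 {H : ℕ → Type*} [∀ n, Countable (H n)] [∀ n, Nontrivial (H n)] {D : Type*}
    (C : CreatingPair H D) (hlocal : C.Local) (hforgetful : C.Forgetful) (hcomplete : C.Complete)
    -- clause (γ)
    (hγ : ∀ (n : ℕ) (A : Set (H n)) (a : H n), a ∈ A → (A \ {a}).Nonempty →
      1 < C.norAt n A → C.norAt n A - 1 ≤ C.norAt n (A \ {a})) :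
    -- 1-norming systems: (1), (2), (3)
    (∀ (K : ℕ → Set ℕ) (g : BinSeq → (m : ℕ) → H m),
      (∀ n, ((2 ^ n : ℕ) : ℕ∞) < ENat.card (H n)) → IsOneNorming K g →
      (C.Linked → Tendsto (fun n => C.norAt n (avoidSet K g n)) atTop atTop →
        VeryExplicitlySourOver cohenReal (C.code (modK K g normInf)) ∧
        (C.BorelNorms → IsSouslin (C.code (modK K g normInf)))) ∧
      (C.Linked → Tendsto (fun n => C.norAt n (avoidSet K g n)) atTop atTop →
        ∀ f : ℕ → ℕ → ℕ, Fast f →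
        (∀ n i, n ≤ i → (f n i : ℝ) ≤ C.norAt i Set.univ) →
        VeryExplicitlySourOver cohenReal (C.code (modK K g (normFun f))) ∧
        (C.BorelNorms → IsSouslin (C.code (modK K g (normFun f))))) ∧
      (∀ (h : ℕ → ℕ → ℕ) (F : Set (ℕ → ℕ)), Regressive h → (∀ f ∈ F, ∀ n, 2 ≤ f n) →
        HClosed h F → F.Countable → F.Nonempty → GeDirected F → C.HLinked h →
        (∀ f ∈ F, ∀ᶠ n in atTop, (f n : ℝ) ≤ C.norAt n (avoidSet K g n)) →
        VeryExplicitlySourOver cohenReal (C.code (modK K g (normFam F))) ∧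
        (C.BorelNorms → IsSouslin (C.code (modK K g (normFam F)))))) ∧
    -- 2-norming systems: (4), (5)
    (∀ U : BinSeq → ℕ → Set ℕ, IsTwoNorming U →
      (C.Linked → Tendsto (fun n => C.norAt n Set.univ) atTop atTop →
        VeryExplicitlySourOver cohenReal (C.code (modU U normInf)) ∧
        (C.BorelNorms → IsSouslin (C.code (modU U normInf)))) ∧
      (C.Linked → Tendsto (fun n => C.norAt n Set.univ) atTop atTop →
        ∀ f : ℕ → ℕ → ℕ, Fast f →
        (∀ n i, n ≤ i → (f n i : ℝ) ≤ C.norAt i Set.univ) →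
        VeryExplicitlySourOver cohenReal (C.code (modU U (normFun f))) ∧
        (C.BorelNorms → IsSouslin (C.code (modU U (normFun f))))) ∧
      (∀ (h : ℕ → ℕ → ℕ) (F : Set (ℕ → ℕ)), Regressive h → (∀ f ∈ F, ∀ n, 2 ≤ f n) →
        HClosed h F → F.Countable → F.Nonempty → GeDirected F → C.HLinked h →
        (∀ f ∈ F, ∀ n, (f n : ℝ) ≤ C.norAt n Set.univ) →
        VeryExplicitlySourOver cohenReal (C.code (modU U (normFam F))) ∧
        (C.BorelNorms → IsSouslin (C.code (modU U (normFam F)))))) := by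
  -- Largeness of the norms of the sets A_n passes to the full sets, which is the form needed for
  -- `NormBase`.
  have hmono : ∀ n (A : Set (H n)), C.norAt n A ≤ C.norAt n Set.univ := fun n A =>
    CreatingPair.norAt_mono hlocal hcomplete (Set.subset_univ A)
  refine ⟨fun K g _ hKg => ?_, fun U hU => ?_⟩
  · obtain ⟨pos, hM⟩ := hKg.exists_branchNorm
    have hMA := analyticSet_slalomK K g
    refine ⟨fun hlink hlim => ?_, fun hlink _ f hf hfu => ?_,
      fun h F hr h2 hcl hF hne hdir hh hu => ?_⟩
    · exact CreatingPair.sour_and_souslin hlocal hforgetful hcomplete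
        (CreatingPair.normBase_slalomInf hlocal hcomplete hγ hlink
          (tendsto_atTop_mono (fun n => hmono n _) hlim)) hM
        (CreatingPair.Cond.mem_modK_iff hlocal
          (CreatingPair.Cond.mem_normInf_iff hlocal hcomplete) K g)
        (fun hB => hB.analyticSet_slalomInf) hMA
    · exact CreatingPair.sour_and_souslin hlocal hforgetful hcomplete
        (CreatingPair.normBase_slalomFun hlocal hcomplete hγ hlink hf hfu) hM
        (CreatingPair.Cond.mem_modK_iff hlocal
          (CreatingPair.Cond.mem_normFun_iff hlocal hcomplete f) K g)
        (fun hB => hB.analyticSet_slalomFun f) hMA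
    · exact CreatingPair.sour_and_souslin hlocal hforgetful hcomplete
        (CreatingPair.normBase_slalomFam hlocal hcomplete hγ hh hr h2 hcl hF hne hdir
          fun f hf => (hu f hf).mono fun n hn => hn.trans (hmono n _)) hM
        (CreatingPair.Cond.mem_modK_iff hlocal
          (CreatingPair.Cond.mem_normFam_iff hlocal hcomplete F) K g)
        (fun hB => hB.analyticSet_slalomFam hF) hMA
  · obtain ⟨pos, a, hM⟩ := hU.exists_branchNorm (H := H)
    have hMA := analyticSet_slalomU (H := H) U
    refine ⟨fun hlink hlim => ?_, fun hlink _ f hf hfu => ?_,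
      fun h F hr h2 hcl hF hne hdir hh hu => ?_⟩
    · exact CreatingPair.sour_and_souslin hlocal hforgetful hcomplete
        (CreatingPair.normBase_slalomInf hlocal hcomplete hγ hlink hlim) hM
        (CreatingPair.Cond.mem_modU_iff hlocal
          (CreatingPair.Cond.mem_normInf_iff hlocal hcomplete) U)
        (fun hB => hB.analyticSet_slalomInf) hMA
    · exact CreatingPair.sour_and_souslin hlocal hforgetful hcomplete
        (CreatingPair.normBase_slalomFun hlocal hcomplete hγ hlink hf hfu) hM
        (CreatingPair.Cond.mem_modU_iff hlocal
          (CreatingPair.Cond.mem_normFun_iff hlocal hcomplete f) U)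
        (fun hB => hB.analyticSet_slalomFun f) hMA
    · exact CreatingPair.sour_and_souslin hlocal hforgetful hcomplete
        (CreatingPair.normBase_slalomFam hlocal hcomplete hγ hh hr h2 hcl hF hne hdir
          fun f hf => Filter.Eventually.of_forall (hu f hf)) hM
        (CreatingPair.Cond.mem_modU_iff hlocal
          (CreatingPair.Cond.mem_normFam_iff hlocal hcomplete F) U)
        (fun hB => hB.analyticSet_slalomFam hF) hMA
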